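/- For a set $A$ in a topological space let $\chi^*_A$ be $1$ on the interior of $A$, $1/2$ on $\partial A$ and $0$ outside $\overline A$. In the sums below, $p^m$ runs over all prime powers ($p$ prime, $m\ge 1$). Let $$\psi(x)=\sum_{p^m}\chi^*_{[0,x]}(p^m)\log p$$ be the normalized Chebyshev function. For $c>0$ and $\varepsilon>0$ let $$\ell_{c,\varepsilon}(\xi)=\frac{c}{\sinh c}\,\frac{\sin\sqrt{(\xi\varepsilon)^2-c^2}}{\sqrt{(\xi\varepsilon)^2-c^2}},\qquad \lambda_{c,\varepsilon}=\ell_{c,\varepsilon}(i/2),$$ $$\eta_{c,\varepsilon}(t)=\chi^*_{[-\varepsilon,\varepsilon]}(t)\,\frac{c}{2\varepsilon\sinh c}\,I_0\bigl(c\sqrt{1-(t/\varepsilon)^2}\bigr),\qquad I_0(t)=\sum_{n\ge 0}\frac{(t/2)^{2n}}{(n!)^2},$$ so that $\eta_{c,\varepsilon}$ is the Fourier transform of $\ell_{c,\varepsilon}$, and put $$\varphi_{x,c,\varepsilon}(t)=\frac1{\lambda_{c,\varepsilon}}\int_0^{\log x}e^{y/2}\,\eta_{c,\varepsilon}(t-y)\,dy,\qquad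 \psi_{c,\varepsilon}(x)=\sum_{p^m}\frac{\log p}{p^{m/2}}\,\varphi_{x,c,\varepsilon}(m\log p).$$ Let $\mu_{c,\varepsilon}$ be the odd function on $\mathbb R$ with $\mu_{c,\varepsilon}(t)=-\int_{-\infty}^t\eta_{c,\varepsilon}(\tau)\,d\tau$ for $t<0$ (so $\mu_{c,\varepsilon}(0)=0$), let $\nu_{c,\varepsilon}(t)=\int_{-\infty}^t\mu_{c,\varepsilon}(\tau)\,d\tau$, write $\mu_c=\mu_{c,1}$ and $\nu_c=\nu_{c,1}$, and let $(\mu_c)_+(\alpha)=\lim_{t\searrow\alpha}\mu_c(t)$. Let $c>0$, $0\le\alpha<1$, $x>100$ and $0<\varepsilon<10^{-2}$ be such that $$B=\frac{\varepsilon x e^{-\varepsilon}\,|\nu_c(\alpha)|}{2(\mu_c)_+(\alpha)}>1,$$ and define $$A(x,c,\varepsilon,\alpha)=e^{2\varepsilon}\log(e^{\varepsilon}x)\Bigl[\frac{2\varepsilon x\,|\nu_c(\alpha)|}{\log B}+2.01\,\varepsilon\sqrt x+\tfrac12\log\log(2x^2)\Bigr].$$ Then $$\psi(e^{-\alpha\varepsilon}x)\le\psi_{c,\varepsilon}(x)+A(x,c,\varepsilon,\alpha)\qquad\text{and}\qquad\psi(e^{\alpha\varepsilon}x)\ge\psi_{c,\varepsilon}(x)-A(x,c,\varepsilon,\alpha).$$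 -/

import Mathlib

noncomputable section

/-- The normalized characteristic function `χ*_A` of a subset `A` of a topological space:
`1` in the interior of `A`, `1/2` on the boundary, `0` outside the closure. -/
def chiStar {X : Type*} [TopologicalSpace X] (A : Set X) (x : X) : ℝ :=
  open Classical in if x ∈ frontier A then 1 / 2 else if x ∈ A then 1 else 0

/-- The normalized Chebyshev function: the sum of `log p` over all prime powers `p ^ m ≤ x`
with `m ≥ 1`, where a prime power equal to `x` is counted with weight `1/2`. -/
def psiStar (x : ℝ) : ℝ :=
  ∑' q : Nat.Primes × ℕ+,
    chiStar (Set.Icc 0 x) ((q.1 : ℝ) ^ (q.2 : ℕ)) * Real.log (q.1 : ℝ)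

/-- The entire function `w ↦ sin w / w`, with value `1` at `0`. -/
def complexSinc (w : ℂ) : ℂ :=
  if w = 0 then 1 else Complex.sin w / w

/-- The Logan function. As `complexSinc` is even, the choice of the square root is immaterial. -/
def logan (c ε : ℝ) (ξ : ℂ) : ℂ :=
  (c : ℂ) / Complex.sinh c * complexSinc (((ξ * ε) ^ 2 - (c : ℂ) ^ 2) ^ (1 / 2 : ℂ))

/-- The real number `λ_{c,ε}`, the value of the Logan function at `i / 2`. -/
def loganLambda (c ε : ℝ) : ℝ :=
  (logan c ε (Complex.I / 2)).re

/-- The modified Bessel function of the first kind of order `0`. -/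
def besselI0 (t : ℝ) : ℝ :=
  ∑' n : ℕ, (t / 2) ^ (2 * n) / ((n.factorial : ℝ) ^ 2)

/-- The Fourier transform of the Logan function. -/
def eta (c ε t : ℝ) : ℝ :=
  chiStar (Set.Icc (-ε) ε) t *
    (c / (2 * ε * Real.sinh c) * besselI0 (c * √(1 - (t / ε) ^ 2)))

/-- The function `φ_{x,c,ε}`: the convolution of `χ_{[0, log x]} exp(·/2)` with `η_{c,ε}`,
divided by `λ_{c,ε}`. -/
def phiKernel (x c ε t : ℝ) : ℝ :=
  1 / loganLambda c ε *
    ∫ y, (Set.Icc 0 (Real.log x)).indicator (fun s => Real.exp (s / 2)) y * eta c ε (t - y)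

/-- The modified Chebyshev function `ψ_{c,ε}`. -/
def psiMod (c ε x : ℝ) : ℝ :=
  ∑' q : Nat.Primes × ℕ+,
    Real.log (q.1 : ℝ) / (q.1 : ℝ) ^ (((q.2 : ℕ) : ℝ) / 2) *
      phiKernel x c ε (((q.2 : ℕ) : ℝ) * Real.log (q.1 : ℝ))

/-- The odd function `μ_{c,ε}`, equal to `-∫_{-∞}^t η_{c,ε}` for `t < 0`. -/
def muFun (c ε t : ℝ) : ℝ :=
  if t < 0 then -∫ τ in Set.Iic t, eta c ε τ
  else if 0 < t then ∫ τ in Set.Iic (-t), eta c ε τ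
  else 0

/-- The function `ν_{c,ε}(t) = ∫_{-∞}^t μ_{c,ε}`. -/
def nuFun (c ε t : ℝ) : ℝ :=
  ∫ τ in Set.Iic t, muFun c ε τ

/-- The quantity `B`. Here `μ_c = μ_{c,1}`, `ν_c = ν_{c,1}`, and `(μ_c)_+ (α)` is the right-hand
limit of `μ_c` at `α` (it is `μ_c (α)` for `0 < α`, and `1/2` for `α = 0`). -/
def boundB (x c ε α : ℝ) : ℝ :=
  ε * x * Real.exp (-ε) * |nuFun c 1 α| / (2 * Function.rightLim (muFun c 1) α)

/-- The error bound `A(x,c,ε,α)`. -/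
def boundA (x c ε α : ℝ) : ℝ :=
  Real.exp (2 * ε) * Real.log (Real.exp ε * x) *
    (2 * ε * x * |nuFun c 1 α| / Real.log (boundB x c ε α)
      + 2.01 * ε * √x + 1 / 2 * Real.log (Real.log (2 * x ^ 2)))

end

/-! Both functions count prime powers `t = p ^ m` with weight `log p` times a cutoff. In terms of
`u = log t - log x`, the cutoff of `ψ_{c,ε}` is the integral of `e^{-s/2} η_{c,ε}(s)` over `s ≥ u`,
divided by its value over the whole line: the factor `λ_{c,ε}` is this total mass. It differs from
the sharp cutoff only for `|u| ≤ ε`, and there by at most `e^{ε/2}` times the mass of `η_{c,ε}`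
beyond `|u|`, a weight that is monotone on either side of `x`. Since it is monotone, it is
equidistributed in residue classes up to its maximum `(μ_c)_+(α)`, so Selberg's sieve bounds its sum
over primes by twice its integral, about `ε x |ν_c(α)|`, divided by `log B`. Squares and higher
powers near `x` are too sparse to need a sieve and give the terms `ε √x` and `log log (2 x²)`. -/

noncomputable section

section SelbergWeights

open Finset ArithmeticFunction BoundingSieve
open scoped ArithmeticFunction.Moebius

theorem sum_divisors_moebius (n : ℕ) : ∑ d ∈ n.divisors, μ d = if n = 1 then 1 else 0 := by
  rw [← coe_mul_zeta_apply, moebius_mul_coe_zeta, one_apply]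

theorem sum_divisors_moebius_mul {k m : ℕ} (h : Squarefree (k * m)) :
    ∑ d ∈ m.divisors, μ (k * d) = if m = 1 then μ k else 0 := by
  have hcop : k.Coprime m := (Nat.squarefree_mul_iff.mp h).1
  calc ∑ d ∈ m.divisors, μ (k * d) = ∑ d ∈ m.divisors, μ k * μ d :=
        sum_congr rfl fun d hd => isMultiplicative_moebius.map_mul_of_coprime
          (hcop.coprime_dvd_right (Nat.dvd_of_mem_divisors hd))
    _ = if m = 1 then μ k else 0 := by
        rw [← mul_sum, sum_divisors_moebius, mul_ite, mul_one, mul_zero]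

theorem sum_moebius_between {k n : ℕ} (hn : Squarefree n) :
    ∑ d ∈ n.divisors with k ∣ d, μ d = if n = k then μ k else 0 := by
  have hn0 : n ≠ 0 := hn.ne_zero
  by_cases hkn : k ∣ n
  · obtain ⟨m, rfl⟩ := hkn
    obtain ⟨hk, hm⟩ := Nat.mul_ne_zero_iff.mp hn0
    have himage : {d ∈ (k * m).divisors | k ∣ d} = m.divisors.image (k * ·) := by
      ext d
      simp only [mem_filter, Nat.mem_divisors, mem_image]
      constructor
      · rintro ⟨⟨hd, -⟩, e, rfl⟩
        exact ⟨e, ⟨Nat.dvd_of_mul_dvd_mul_left (Nat.pos_of_ne_zero hk) hd, hm⟩, rfl⟩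
      · rintro ⟨e, ⟨he, -⟩, rfl⟩
        exact ⟨⟨Nat.mul_dvd_mul_left k he, hn0⟩, Dvd.intro e rfl⟩
    rw [himage, sum_image fun a _ b _ h => Nat.eq_of_mul_eq_mul_left (Nat.pos_of_ne_zero hk) h,
      sum_divisors_moebius_mul hn]
    simp only [Nat.mul_eq_left hk]
  · rw [if_neg fun h => hkn h.symm.dvd, filter_false_of_mem, sum_empty]
    exact fun d hd hkd => hkn (hkd.trans (Nat.dvd_of_mem_divisors hd))

variable (s : SelbergSieve)

/-- The divisors of the sifting modulus of size at most the square root of the level: the support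
of Selberg's weights. -/
def selbergDivisors : Finset ℕ :=
  {d ∈ s.prodPrimes.divisors | (d : ℝ) ^ 2 ≤ s.level}

/-- The sum of the terms `g(k)` over `selbergDivisors`, usually denoted by `S`; its reciprocal is
the main term of Selberg's upper bound sieve. -/
def selbergMass : ℝ :=
  ∑ k ∈ selbergDivisors s, s.selbergTerms k

/-- The sum of `g(k) / ν(d)` over the pairs `d ∣ k` in `selbergDivisors`. It controls the total size
of Selberg's weights, hence the error term of the sieve. -/
def selbergDivisorMass : ℝ :=
  ∑ k ∈ selbergDivisors s, s.selbergTerms k * ∑ d ∈ k.divisors, (s.nu d)⁻¹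

/-- Selberg's weights `μ(d) ν(d)⁻¹ S⁻¹ ∑ g(k)`, the sum being over the multiples `k` of `d` in
`selbergDivisors`. They minimize the main term among the weights supported on `selbergDivisors`
with value `1` at `1`. -/
def selbergWeight (d : ℕ) : ℝ :=
  μ d * (s.nu d)⁻¹ / selbergMass s * ∑ k ∈ selbergDivisors s with d ∣ k, s.selbergTerms k

variable {s}

theorem dvd_prodPrimes_of_mem_selbergDivisors {k : ℕ} (hk : k ∈ selbergDivisors s) :
    k ∣ s.prodPrimes :=
  Nat.dvd_of_mem_divisors (mem_filter.mp hk).1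

theorem one_mem_selbergDivisors : 1 ∈ selbergDivisors s := by
  simp [selbergDivisors, prodPrimes_ne_zero, s.one_le_level]

theorem selbergMass_pos : 0 < selbergMass s :=
  sum_pos (fun _ hk => selbergTerms_pos (dvd_prodPrimes_of_mem_selbergDivisors hk))
    ⟨1, one_mem_selbergDivisors⟩

theorem selbergWeight_one : selbergWeight s 1 = 1 := by
  have hS : selbergMass s ≠ 0 := selbergMass_pos.ne'
  have hsum : ∑ k ∈ selbergDivisors s with 1 ∣ k, s.selbergTerms k = selbergMass s := by
    simp only [one_dvd, filter_true, selbergMass]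
  rw [selbergWeight, hsum, moebius_apply_one, s.nu_mult.map_one, inv_one, Int.cast_one, mul_one,
    one_div_mul_cancel hS]

theorem nu_mul_selbergWeight {d : ℕ} (hd : d ∣ s.prodPrimes) :
    s.nu d * selbergWeight s d =
      ∑ k ∈ selbergDivisors s, if d ∣ k then μ d * (s.selbergTerms k / selbergMass s) else 0 := by
  have hν : s.nu d ≠ 0 := nu_ne_zero hd
  rw [← sum_filter, ← mul_sum, ← sum_div, selbergWeight]
  field_simp

theorem sum_nu_mul_selbergWeight (l : ℕ) :
    (∑ d ∈ s.prodPrimes.divisors, if l ∣ d then s.nu d * selbergWeight s d else 0) =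
      if l ∈ selbergDivisors s then μ l * (s.selbergTerms l / selbergMass s) else 0 := by
  have hinner : ∀ k ∈ selbergDivisors s,
      (∑ d ∈ s.prodPrimes.divisors, if l ∣ d then
        if d ∣ k then (μ d : ℝ) * (s.selbergTerms k / selbergMass s) else 0 else 0) =
      if k = l then μ l * (s.selbergTerms l / selbergMass s) else 0 := by
    intro k hk
    have hkP := dvd_prodPrimes_of_mem_selbergDivisors hk
    have hsum : (∑ d ∈ k.divisors with l ∣ d, (μ d : ℝ)) = if k = l then (μ l : ℝ) else 0 := by
      exact_mod_cast sum_moebius_between (squarefree_of_dvd_prodPrimes hkP)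
    simp_rw [← ite_and, and_comm (a := l ∣ _), ite_and]
    rw [← sum_filter, Nat.divisors_filter_dvd_of_dvd prodPrimes_ne_zero hkP, ← sum_filter,
      ← sum_mul, hsum]
    split_ifs with hkl
    · rw [hkl]
    · rw [zero_mul]
  calc (∑ d ∈ s.prodPrimes.divisors, if l ∣ d then s.nu d * selbergWeight s d else 0)
      = ∑ d ∈ s.prodPrimes.divisors, ∑ k ∈ selbergDivisors s, if l ∣ d then
          if d ∣ k then (μ d : ℝ) * (s.selbergTerms k / selbergMass s) else 0 else 0 := by
        refine sum_congr rfl fun d hd => ?_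
        rw [nu_mul_selbergWeight (Nat.dvd_of_mem_divisors hd), ite_sum_zero]
    _ = ∑ k ∈ selbergDivisors s, if k = l then μ l * (s.selbergTerms l / selbergMass s) else 0 := by
        rw [sum_comm]
        exact sum_congr rfl hinner
    _ = _ := sum_ite_eq' _ _ _

theorem mainSum_lambdaSquared_selbergWeight :
    s.mainSum (lambdaSquared (selbergWeight s)) = (selbergMass s)⁻¹ := by
  have hS : selbergMass s ≠ 0 := selbergMass_pos.ne'
  have hterm : ∀ l ∈ selbergDivisors s,
      (s.selbergTerms l)⁻¹ * (μ l * (s.selbergTerms l / selbergMass s)) ^ 2 =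
        s.selbergTerms l / selbergMass s ^ 2 := by
    intro l hl
    have hlP := dvd_prodPrimes_of_mem_selbergDivisors hl
    have hg : s.selbergTerms l ≠ 0 := (selbergTerms_pos hlP).ne'
    have hμ : (μ l : ℝ) ^ 2 = 1 := by
      exact_mod_cast moebius_sq_eq_one_of_squarefree (squarefree_of_dvd_prodPrimes hlP)
    rw [mul_pow, hμ]
    field_simp
  calc s.mainSum (lambdaSquared (selbergWeight s))
      = ∑ l ∈ selbergDivisors s,
          (s.selbergTerms l)⁻¹ * (μ l * (s.selbergTerms l / selbergMass s)) ^ 2 := by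
        simp only [mainSum_lambdaSquared_eq_sum_mul_sum_sq, sum_nu_mul_selbergWeight, ite_pow,
          zero_pow two_ne_zero, mul_ite, mul_zero]
        rw [← sum_filter, filter_mem_eq_inter, selbergDivisors,
          inter_eq_right.mpr (filter_subset _ _)]
    _ = selbergMass s / selbergMass s ^ 2 := by
        rw [sum_congr rfl hterm, ← sum_div, ← selbergMass]
    _ = (selbergMass s)⁻¹ := by field_simp

theorem sum_abs_selbergWeight_le :
    ∑ d ∈ s.prodPrimes.divisors, |selbergWeight s d| ≤ selbergDivisorMass s / selbergMass s := by
  have hS : 0 < selbergMass s := selbergMass_pos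
  have habs : ∀ d ∈ s.prodPrimes.divisors, |selbergWeight s d| ≤
      ∑ k ∈ selbergDivisors s,
        if d ∣ k then s.selbergTerms k / selbergMass s * (s.nu d)⁻¹ else 0 := by
    intro d hd
    have hν : 0 < s.nu d := nu_pos_of_dvd_prodPrimes (Nat.dvd_of_mem_divisors hd)
    have hg : 0 ≤ ∑ k ∈ selbergDivisors s with d ∣ k, s.selbergTerms k :=
      sum_nonneg fun k hk => (selbergTerms_pos
        (dvd_prodPrimes_of_mem_selbergDivisors (mem_filter.mp hk).1)).le
    have hμ : |(μ d : ℝ)| ≤ 1 := by exact_mod_cast abs_moebius_le_one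
    rw [← sum_filter, ← sum_mul, ← sum_div, selbergWeight, abs_mul, abs_div, abs_mul, abs_of_pos hS,
      abs_of_nonneg hg, abs_inv, abs_of_pos hν, div_mul_eq_mul_div, div_mul_eq_mul_div,
      mul_comm (∑ k ∈ _, _)]
    gcongr
    exact mul_le_of_le_one_left (by positivity) hμ
  refine (sum_le_sum habs).trans_eq ?_
  rw [sum_comm, selbergDivisorMass, sum_div]
  refine sum_congr rfl fun k hk => ?_
  rw [← sum_filter, Nat.divisors_filter_dvd_of_dvd prodPrimes_ne_zero
    (dvd_prodPrimes_of_mem_selbergDivisors hk), ← mul_sum, div_mul_eq_mul_div]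

theorem sum_abs_lambdaSquared_le (w : ℕ → ℝ) (n : ℕ) :
    ∑ d ∈ n.divisors, |lambdaSquared w d| ≤ (∑ d ∈ n.divisors, |w d|) ^ 2 := by
  have habs : ∀ d ∈ n.divisors, |lambdaSquared w d| ≤ ∑ d₁ ∈ n.divisors, ∑ d₂ ∈ n.divisors,
      if d = d₁.lcm d₂ then |w d₁| * |w d₂| else 0 := by
    intro d hd
    have hsub : d.divisors ⊆ n.divisors :=
      Nat.divisors_subset_of_dvd (Nat.mem_divisors.mp hd).2 (Nat.dvd_of_mem_divisors hd)
    have hnonneg : ∀ d₁ d₂, 0 ≤ if d = d₁.lcm d₂ then |w d₁| * |w d₂| else 0 :=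
      fun d₁ d₂ => by positivity
    calc |lambdaSquared w d|
        ≤ ∑ d₁ ∈ d.divisors, ∑ d₂ ∈ d.divisors, if d = d₁.lcm d₂ then |w d₁| * |w d₂| else 0 := by
          refine (abs_sum_le_sum_abs _ _).trans (sum_le_sum fun d₁ _ =>
            (abs_sum_le_sum_abs _ _).trans (sum_le_sum fun d₂ _ => le_of_eq ?_))
          split_ifs
          · exact abs_mul _ _
          · exact abs_zero
      _ ≤ _ := (sum_le_sum fun d₁ _ => sum_le_sum_of_subset_of_nonneg hsub
            fun d₂ _ _ => hnonneg d₁ d₂).trans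
          (sum_le_sum_of_subset_of_nonneg hsub fun d₁ _ _ => sum_nonneg fun d₂ _ => hnonneg d₁ d₂)
  refine (sum_le_sum habs).trans_eq ?_
  rw [sum_comm, sq, sum_mul_sum]
  refine sum_congr rfl fun d₁ hd₁ => ?_
  rw [sum_comm]
  refine sum_congr rfl fun d₂ hd₂ => sum_ite_eq_of_mem' _ _ _ ?_
  exact Nat.mem_divisors.mpr ⟨Nat.lcm_dvd (Nat.dvd_of_mem_divisors hd₁)
    (Nat.dvd_of_mem_divisors hd₂), (Nat.mem_divisors.mp hd₁).2⟩

theorem siftedSum_le_of_abs_rem_le {M : ℝ} (hM : ∀ d, d ∣ s.prodPrimes → |s.rem d| ≤ M) :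
    s.siftedSum ≤
      s.totalMass / selbergMass s + M * (selbergDivisorMass s / selbergMass s) ^ 2 := by
  have hM0 : 0 ≤ M := (abs_nonneg _).trans (hM 1 (one_dvd _))
  have herr : s.errSum (lambdaSquared (selbergWeight s)) ≤
      M * (selbergDivisorMass s / selbergMass s) ^ 2 :=
    calc s.errSum (lambdaSquared (selbergWeight s))
        ≤ ∑ d ∈ s.prodPrimes.divisors, |lambdaSquared (selbergWeight s) d| * M := by
          unfold errSum
          gcongr with d hd
          exact hM d (Nat.dvd_of_mem_divisors hd)
      _ ≤ M * (∑ d ∈ s.prodPrimes.divisors, |selbergWeight s d|) ^ 2 := by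
          rw [← sum_mul, mul_comm]
          exact mul_le_mul_of_nonneg_left (sum_abs_lambdaSquared_le _ _) hM0
      _ ≤ _ := by
          gcongr
          exact sum_abs_selbergWeight_le
  have hsieve := siftedSum_le_mainSum_errSum_of_upperMoebius (s := s.toBoundingSieve) _
    (upperMoebius_lambdaSquared _ (selbergWeight_one (s := s)))
  rw [mainSum_lambdaSquared_selbergWeight, ← div_eq_mul_inv] at hsieve
  linarith

end SelbergWeights

section ArithmeticProgressions

open Finset MeasureTheory

variable {f : ℝ → ℝ} {a b M : ℝ}

theorem sum_int_Icc_eq_sum_range (g : ℤ → ℝ) (m : ℤ) (J : ℕ) :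
    ∑ k ∈ Icc m (m + J), g k = ∑ i ∈ range (J + 1), g (m + i) := by
  rw [Int.Icc_eq_finset_map, sum_map, show (m + J + 1 - m).toNat = J + 1 by omega]
  rfl

theorem sum_int_Icc_mem_Icc_of_antitoneOn {m n : ℤ} (hf : AntitoneOn f (Set.Icc m n))
    (hmn : m ≤ n) :
    ∑ k ∈ Icc m n, f k ∈
      Set.Icc ((∫ t in (m : ℝ)..n, f t) + f n) ((∫ t in (m : ℝ)..n, f t) + f m) := by
  obtain ⟨J, rfl⟩ := Int.le.dest hmn
  have hf' : AntitoneOn f (Set.Icc m (m + J)) := by exact_mod_cast hf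
  have hlower := hf'.integral_le_sum
  have hupper := hf'.sum_le_integral
  rw [sum_int_Icc_eq_sum_range fun k => f k]
  push_cast
  constructor
  · rw [sum_range_succ]
    linarith
  · rw [sum_range_succ']
    push_cast at *
    rw [add_zero]
    linarith

theorem integral_mem_Icc_of_le_add_one (hf : AntitoneOn f (Set.Icc a b))
    (hf0 : ∀ t ∈ Set.Icc a b, 0 ≤ f t) (hM : ∀ t ∈ Set.Icc a b, f t ≤ M) (hab : a ≤ b)
    (hb : b ≤ a + 1) :
    (∫ t in a..b, f t) ∈ Set.Icc 0 M := by
  have hM0 : 0 ≤ M := (hf0 a ⟨le_rfl, hab⟩).trans (hM a ⟨le_rfl, hab⟩)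
  refine ⟨intervalIntegral.integral_nonneg hab hf0, ?_⟩
  calc (∫ t in a..b, f t) ≤ ∫ _ in a..b, M :=
        intervalIntegral.integral_mono_on hab (Set.uIcc_of_le hab ▸ hf).intervalIntegrable
          intervalIntegrable_const hM
    _ = (b - a) * M := by rw [intervalIntegral.integral_const, smul_eq_mul]
    _ ≤ M := mul_le_of_le_one_left hM0 (by linarith)

theorem abs_sum_int_sub_integral_le (hf : AntitoneOn f (Set.Icc a b))
    (hf0 : ∀ t ∈ Set.Icc a b, 0 ≤ f t) (hM : ∀ t ∈ Set.Icc a b, f t ≤ M) (hab : a ≤ b) :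
    |∑ k ∈ Icc ⌈a⌉ ⌊b⌋, f k - ∫ t in a..b, f t| ≤ M := by
  have hanti : ∀ {u v : ℝ}, a ≤ u → v ≤ b → AntitoneOn f (Set.Icc u v) :=
    fun hu hv => hf.mono (Set.Icc_subset_Icc hu hv)
  have hint : ∀ {u v : ℝ}, a ≤ u → u ≤ v → v ≤ b → IntervalIntegrable f volume u v :=
    fun hu huv hv => (Set.uIcc_of_le huv ▸ hanti hu hv).intervalIntegrable
  have hshort : ∀ {u v C : ℝ}, a ≤ u → u ≤ v → v ≤ b → v ≤ u + 1 → (∀ t ∈ Set.Icc u v, f t ≤ C) →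
      (∫ t in u..v, f t) ∈ Set.Icc 0 C :=
    fun hu huv hv huv1 hC => integral_mem_Icc_of_le_add_one (hanti hu hv)
      (fun t ht => hf0 t ⟨hu.trans ht.1, ht.2.trans hv⟩) hC huv huv1
  have ham : a ≤ ⌈a⌉ := Int.le_ceil a
  have hma : (⌈a⌉ : ℝ) < a + 1 := Int.ceil_lt_add_one a
  have hnb : (⌊b⌋ : ℝ) ≤ b := Int.floor_le b
  have hbn : b < ⌊b⌋ + 1 := Int.lt_floor_add_one b
  rcases lt_or_ge ⌊b⌋ ⌈a⌉ with hlt | hmn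
  · have hnm : (⌊b⌋ : ℝ) + 1 ≤ ⌈a⌉ := by exact_mod_cast hlt
    obtain ⟨h0, h1⟩ := hshort le_rfl hab le_rfl (by linarith) hM
    rwa [Icc_eq_empty hlt.not_ge, sum_empty, zero_sub, abs_neg, abs_of_nonneg h0]
  · have hmn' : (⌈a⌉ : ℝ) ≤ ⌊b⌋ := by exact_mod_cast hmn
    obtain ⟨hlower, hupper⟩ := sum_int_Icc_mem_Icc_of_antitoneOn (hanti ham hnb) hmn
    have hsplit : (∫ t in a..b, f t) = (∫ t in a..⌈a⌉, f t) + (∫ t in (⌈a⌉ : ℝ)..⌊b⌋, f t) +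
        ∫ t in ⌊b⌋..b, f t := by
      rw [intervalIntegral.integral_add_adjacent_intervals (hint le_rfl ham (hmn'.trans hnb))
        (hint ham hmn' hnb), intervalIntegral.integral_add_adjacent_intervals
        (hint le_rfl (ham.trans hmn') hnb) (hint (ham.trans hmn') hnb le_rfl)]
    obtain ⟨hfirst0, hfirst⟩ := hshort le_rfl ham (hmn'.trans hnb) hma.le
      fun t ht => hM t ⟨ht.1, ht.2.trans (hmn'.trans hnb)⟩
    obtain ⟨hlast0, hlast⟩ := hshort (ham.trans hmn') hnb le_rfl hbn.le
      fun t ht => hf ⟨ham.trans hmn', hnb⟩ ⟨(ham.trans hmn').trans ht.1, ht.2⟩ ht.1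
    have hmM := hM _ ⟨ham, hmn'.trans hnb⟩
    rw [abs_le]
    constructor <;> linarith

theorem abs_sum_modEq_sub_integral_div_le_of_antitoneOn (hf : AntitoneOn f (Set.Icc a b))
    (hf0 : ∀ t ∈ Set.Icc a b, 0 ≤ f t) (hM : ∀ t ∈ Set.Icc a b, f t ≤ M) (hab : a ≤ b)
    {q : ℕ} (hq : 0 < q) (r : ℤ) :
    |∑ n ∈ Icc ⌈a⌉ ⌊b⌋ with n ≡ r [ZMOD q], f n - (∫ t in a..b, f t) / q| ≤ M := by
  have hq' : (0 : ℝ) < q := by exact_mod_cast hq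
  have hmaps : ∀ s, s ∈ Set.Icc ((a - r) / q) ((b - r) / q) → q * s + r ∈ Set.Icc a b := by
    intro s hs
    rw [Set.mem_Icc, div_le_iff₀ hq', le_div_iff₀ hq'] at hs
    constructor <;> linarith
  have hsum : ∑ n ∈ Icc ⌈a⌉ ⌊b⌋ with n ≡ r [ZMOD q], f n =
      ∑ k ∈ Icc ⌈(a - r) / q⌉ ⌊(b - r) / q⌋, f (q * k + r) := by
    symm
    refine sum_bij (fun k _ => q * k + r) (fun k hk => ?_) (fun k _ l _ h => ?_) (fun n hn => ?_)
      fun k _ => by push_cast; rfl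
    · rw [mem_Icc, Int.ceil_le, Int.le_floor] at hk
      rw [mem_filter, mem_Icc, Int.ceil_le, Int.le_floor]
      push_cast
      exact ⟨hmaps k hk, Int.modEq_iff_dvd.mpr ⟨-k, by ring⟩⟩
    · have hq0 : q ≠ 0 := hq.ne'
      simpa [hq0] using h
    · rw [mem_filter, mem_Icc, Int.ceil_le, Int.le_floor] at hn
      obtain ⟨hn, hnr⟩ := hn
      obtain ⟨k, hk⟩ := hnr.symm.dvd
      obtain rfl : n = q * k + r := by linarith
      push_cast at hn
      refine ⟨k, ?_, rfl⟩
      rw [mem_Icc, Int.ceil_le, Int.le_floor, div_le_iff₀ hq', le_div_iff₀ hq']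
      constructor <;> linarith
  have hintegral : (∫ t in a..b, f t) / q =
      ∫ s in ((a - r) / q)..((b - r) / q), f (q * s + r) := by
    rw [intervalIntegral.integral_comp_mul_add _ hq'.ne', mul_div_cancel₀ _ hq'.ne',
      mul_div_cancel₀ _ hq'.ne', sub_add_cancel, sub_add_cancel, smul_eq_mul, inv_mul_eq_div]
  rw [hsum, hintegral]
  refine abs_sum_int_sub_integral_le (fun s hs t ht hst => hf (hmaps s hs) (hmaps t ht) ?_)
    (fun s hs => hf0 _ (hmaps s hs)) (fun s hs => hM _ (hmaps s hs)) (by gcongr)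
  gcongr

theorem abs_sum_modEq_sub_integral_div_le_of_monotoneOn (hf : MonotoneOn f (Set.Icc a b))
    (hf0 : ∀ t ∈ Set.Icc a b, 0 ≤ f t) (hM : ∀ t ∈ Set.Icc a b, f t ≤ M) (hab : a ≤ b)
    {q : ℕ} (hq : 0 < q) (r : ℤ) :
    |∑ n ∈ Icc ⌈a⌉ ⌊b⌋ with n ≡ r [ZMOD q], f n - (∫ t in a..b, f t) / q| ≤ M := by
  have hmaps : ∀ t, t ∈ Set.Icc (-b) (-a) → -t ∈ Set.Icc a b :=
    fun t ht => ⟨le_neg_of_le_neg ht.2, neg_le_of_neg_le ht.1⟩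
  have hreflect := abs_sum_modEq_sub_integral_div_le_of_antitoneOn (f := fun t => f (-t))
    (fun s hs t ht hst => hf (hmaps t ht) (hmaps s hs) (neg_le_neg hst))
    (fun t ht => hf0 _ (hmaps t ht)) (fun t ht => hM _ (hmaps t ht)) (neg_le_neg hab) hq (-r)
  have hsum : ∑ n ∈ Icc ⌈-b⌉ ⌊-a⌋ with n ≡ -r [ZMOD q], f (-n) =
      ∑ n ∈ Icc ⌈a⌉ ⌊b⌋ with n ≡ r [ZMOD q], f n := by
    have hmem : ∀ n : ℤ, (n ∈ Icc ⌈-b⌉ ⌊-a⌋ ∧ n ≡ -r [ZMOD q]) ↔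
        (-n ∈ Icc ⌈a⌉ ⌊b⌋ ∧ -n ≡ r [ZMOD q]) := by
      intro n
      rw [← Int.neg_modEq_neg (b := r), neg_neg, Int.ceil_neg, Int.floor_neg, mem_Icc, mem_Icc,
        and_comm (a := -⌊b⌋ ≤ n), neg_le, le_neg]
    refine sum_nbij' (fun n => -n) (fun n => -n) (fun n hn => ?_) (fun n hn => ?_)
      (fun n _ => neg_neg n) (fun n _ => neg_neg n) fun n _ => by push_cast; rfl
    · exact mem_filter.mpr ((hmem n).mp (mem_filter.mp hn))
    · exact mem_filter.mpr ((hmem (-n)).mpr (by rw [neg_neg]; exact mem_filter.mp hn))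
  rwa [hsum, intervalIntegral.integral_comp_neg, neg_neg, neg_neg] at hreflect

end ArithmeticProgressions

section OddSquarefree

open Finset

/-- The odd squarefree positive integers up to `N`. -/
def oddSquarefree (N : ℕ) : Finset ℕ :=
  {k ∈ Icc 1 N | Odd k ∧ Squarefree k}

/-- The sum of `1 / φ(k)` over the odd squarefree integers `k ≤ N`, a rational number so that its
small values can be decided. -/
def oddTotientInvSum (N : ℕ) : ℚ :=
  ∑ k ∈ oddSquarefree N, 1 / (k.totient : ℚ)

/-- The sum of `σ(k) / φ(k)` over the odd squarefree integers `k ≤ N`, a rational number so that its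
small values can be decided. -/
def oddSigmaTotientSum (N : ℕ) : ℚ :=
  ∑ k ∈ oddSquarefree N, ((∑ d ∈ k.divisors, d : ℕ) : ℚ) / k.totient

theorem mem_oddSquarefree {N k : ℕ} :
    k ∈ oddSquarefree N ↔ (1 ≤ k ∧ k ≤ N) ∧ Odd k ∧ Squarefree k := by
  simp only [oddSquarefree, mem_filter, mem_Icc]

theorem oddSquarefree_mono : Monotone oddSquarefree :=
  fun _ _ h => filter_subset_filter _ (Icc_subset_Icc_right h)

theorem totient_eq_mul_prod_one_sub_inv (k : ℕ) :
    (k.totient : ℝ) = k * ∏ p ∈ k.primeFactors, (1 - (p : ℝ)⁻¹) := by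
  have h := congrArg (fun q : ℚ => (q : ℝ)) (Nat.totient_eq_mul_prod_factors k)
  push_cast at h
  exact h

theorem hasSum_inv_factoredNumbers_primeFactors {k : ℕ} (hk : k ≠ 0) :
    HasSum (fun m : Nat.factoredNumbers k.primeFactors => ((m : ℕ) : ℝ)⁻¹) (k / k.totient) := by
  let f : ℕ →* ℝ := ((invMonoidWithZeroHom (G₀ := ℝ)) : ℝ →* ℝ).comp (Nat.castRingHom ℝ)
  have hf : ∀ {p : ℕ}, p.Prime → ‖f p‖ < 1 := by
    intro p hp
    change ‖(p : ℝ)⁻¹‖ < 1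
    rw [norm_inv, Real.norm_natCast]
    exact inv_lt_one_of_one_lt₀ (by exact_mod_cast hp.one_lt)
  have hprimes : {p ∈ k.primeFactors | p.Prime} = k.primeFactors :=
    filter_true_of_mem fun p hp => Nat.prime_of_mem_primeFactors hp
  have hprod : ∏ p ∈ k.primeFactors, (1 - f p)⁻¹ = k / k.totient := by
    change ∏ p ∈ k.primeFactors, (1 - (p : ℝ)⁻¹)⁻¹ = _
    rw [prod_inv_distrib, totient_eq_mul_prod_one_sub_inv, div_mul_eq_div_div,
      div_self (by exact_mod_cast hk), one_div]
  have hsum := (EulerProduct.summable_and_hasSum_factoredNumbers_prod_filter_prime_geometric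
    hf k.primeFactors).2
  rwa [hprimes, hprod] at hsum

theorem sum_one_div_le_one_div_totient {k : ℕ} (hk : Squarefree k) (R : Finset ℕ)
    (hR : ∀ n ∈ R, n ≠ 0 ∧ n.primeFactors = k.primeFactors) :
    ∑ n ∈ R, 1 / (n : ℝ) ≤ 1 / (k.totient : ℝ) := by
  have hk0 : (0 : ℝ) < k := by exact_mod_cast Nat.pos_of_ne_zero hk.ne_zero
  have hdvd : ∀ n ∈ R, k ∣ n := fun n hn => by
    rw [← Nat.prod_primeFactors_of_squarefree hk, ← (hR n hn).2]
    exact Nat.prod_primeFactors_dvd n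
  have hmem : ∀ n ∈ R, n / k ∈ Nat.factoredNumbers k.primeFactors := fun n hn =>
    Nat.mem_factoredNumbers_of_dvd
      (Nat.mem_factoredNumbers_of_primeFactors_subset (hR n hn).1 (hR n hn).2.subset)
      (Nat.div_dvd_of_dvd (hdvd n hn))
  have hquot : ∑ n ∈ R, ((n / k : ℕ) : ℝ)⁻¹ ≤ k / k.totient := by
    have hinj : Set.InjOn (· / k) (R : Set ℕ) := fun m hm n hn h => by
      rw [← Nat.div_mul_cancel (hdvd m hm), ← Nat.div_mul_cancel (hdvd n hn)]
      exact congrArg (· * k) h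
    have hsum : HasSum ((Nat.factoredNumbers k.primeFactors).indicator fun m : ℕ => (m : ℝ)⁻¹)
        (k / k.totient) :=
      hasSum_subtype_iff_indicator.mp (hasSum_inv_factoredNumbers_primeFactors hk.ne_zero)
    calc ∑ n ∈ R, ((n / k : ℕ) : ℝ)⁻¹
        = ∑ n ∈ R, (Nat.factoredNumbers k.primeFactors).indicator
            (fun m : ℕ => (m : ℝ)⁻¹) (n / k) :=
          sum_congr rfl fun n hn =>
            (Set.indicator_of_mem (hmem n hn) fun m : ℕ => (m : ℝ)⁻¹).symm
      _ = ∑ m ∈ R.image (· / k), (Nat.factoredNumbers k.primeFactors).indicator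
            (fun m : ℕ => (m : ℝ)⁻¹) m := (sum_image hinj).symm
      _ ≤ k / k.totient :=
          sum_le_hasSum _ (fun m _ => Set.indicator_nonneg (fun m _ => by positivity) m) hsum
  calc ∑ n ∈ R, 1 / (n : ℝ) = 1 / k * ∑ n ∈ R, ((n / k : ℕ) : ℝ)⁻¹ := by
        rw [mul_sum]
        refine sum_congr rfl fun n hn => ?_
        rw [Nat.cast_div (hdvd n hn) hk0.ne']
        field_simp
    _ ≤ 1 / k * (k / k.totient) := by gcongr
    _ = 1 / k.totient := by field_simp

theorem prod_primeFactors_mem_oddSquarefree {n N : ℕ} (hn : n ∈ Icc 1 N) (hodd : Odd n) :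
    ∏ p ∈ n.primeFactors, p ∈ oddSquarefree N := by
  obtain ⟨hn1, hnN⟩ := mem_Icc.mp hn
  have hdvd := Nat.prod_primeFactors_dvd n
  refine mem_oddSquarefree.mpr ⟨⟨Nat.pos_of_dvd_of_pos hdvd hn1,
    (Nat.le_of_dvd hn1 hdvd).trans hnN⟩, hodd.of_dvd_nat hdvd, ?_⟩
  refine squarefree_prod_of_pairwise_isCoprime (fun p hp q hq hpq => ?_)
    fun p hp => (Nat.prime_of_mem_primeFactors hp).squarefree
  exact Nat.coprime_iff_isRelPrime.mp ((Nat.coprime_primes (Nat.prime_of_mem_primeFactors hp)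
    (Nat.prime_of_mem_primeFactors hq)).mpr hpq)

theorem sum_odd_one_div_le_oddTotientInvSum (N : ℕ) :
    ∑ n ∈ Icc 1 N with Odd n, 1 / (n : ℝ) ≤ oddTotientInvSum N := by
  have hmaps : ∀ n ∈ {n ∈ Icc 1 N | Odd n}, ∏ p ∈ n.primeFactors, p ∈ oddSquarefree N :=
    fun n hn => prod_primeFactors_mem_oddSquarefree (mem_filter.mp hn).1 (mem_filter.mp hn).2
  rw [← sum_fiberwise_of_maps_to hmaps, oddTotientInvSum]
  push_cast
  refine sum_le_sum fun k hk => ?_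
  refine sum_one_div_le_one_div_totient (mem_oddSquarefree.mp hk).2.2 _ fun n hn => ?_
  obtain ⟨hn, hnk⟩ := mem_filter.mp hn
  have hn1 := (mem_Icc.mp (mem_filter.mp hn).1).1
  exact ⟨by omega, by rw [← hnk, Nat.primeFactors_prod_primeFactors]⟩

theorem log_add_le_log_add_div {x h : ℝ} (hx : 0 < x) (hxh : 0 < x + h) :
    Real.log (x + h) ≤ Real.log x + h / x := by
  have hlog := Real.log_le_sub_one_of_pos (div_pos hxh hx)
  rw [Real.log_div hxh.ne' hx.ne', add_div, div_self hx.ne'] at hlog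
  linarith

theorem half_log_add_quarter_le_sum_range_odd {j : ℕ} (hj : 8 ≤ j) :
    1 / 2 * Real.log (2 * (2 * j + 1)) + 1 / 4 ≤ ∑ i ∈ range j, 1 / (2 * (i : ℝ) + 1) := by
  induction j, hj using Nat.le_induction with
  | base =>
    have hlog : Real.log (2 * (2 * ((8 : ℕ) : ℝ) + 1)) ≤ 5 * Real.log 2 + 1 / 16 :=
      calc Real.log (2 * (2 * ((8 : ℕ) : ℝ) + 1)) = Real.log (2 ^ 5 + 2) := by norm_num
        _ ≤ Real.log (2 ^ 5) + 2 / 2 ^ 5 := log_add_le_log_add_div (by norm_num) (by norm_num)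
        _ = 5 * Real.log 2 + 1 / 16 := by rw [Real.log_pow]; norm_num
    have hlog2 := Real.log_two_lt_d9
    simp only [sum_range_succ, sum_range_zero]
    norm_num at hlog ⊢
    linarith
  | succ j hj ih =>
    have hlog : Real.log (2 * (2 * ((j + 1 : ℕ) : ℝ) + 1)) ≤
        Real.log (2 * (2 * j + 1)) + 4 / (2 * (2 * j + 1)) := by
      rw [show (2 * (2 * ((j + 1 : ℕ) : ℝ) + 1)) = 2 * (2 * j + 1) + 4 by push_cast; ring]
      exact log_add_le_log_add_div (by positivity) (by positivity)
    have hterm : 1 / (2 * (j : ℝ) + 1) = 1 / 2 * (4 / (2 * (2 * j + 1))) := by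
      field_simp
      norm_num
    rw [sum_range_succ, hterm]
    linarith

theorem half_log_add_quarter_le_oddTotientInvSum {N : ℕ} (hN : 15 ≤ N) :
    1 / 2 * Real.log (2 * (N + 1)) + 1 / 4 ≤ oddTotientInvSum N := by
  have hNj : ((N + 1 : ℕ) : ℝ) ≤ ((2 * ((N + 1) / 2) + 1 : ℕ) : ℝ) := by
    exact_mod_cast (by omega : N + 1 ≤ 2 * ((N + 1) / 2) + 1)
  have hlog : Real.log (2 * ((N : ℝ) + 1)) ≤ Real.log (2 * (2 * ((N + 1) / 2 : ℕ) + 1)) := by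
    push_cast at hNj
    gcongr
  have hsub : (range ((N + 1) / 2)).image (fun i => 2 * i + 1) ⊆ {n ∈ Icc 1 N | Odd n} := by
    intro n hn
    simp only [mem_image, mem_range, mem_filter, mem_Icc] at hn ⊢
    obtain ⟨i, hi, rfl⟩ := hn
    exact ⟨by omega, odd_two_mul_add_one i⟩
  have hsum : ∑ i ∈ range ((N + 1) / 2), 1 / (2 * (i : ℝ) + 1) ≤
      ∑ n ∈ Icc 1 N with Odd n, 1 / (n : ℝ) := by
    refine le_of_eq_of_le ?_ (sum_le_sum_of_subset_of_nonneg hsub fun _ _ _ => by positivity)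
    rw [sum_image fun i _ j _ h => by simpa using h]
    push_cast
    rfl
  have hhalf := half_log_add_quarter_le_sum_range_odd (j := (N + 1) / 2) (by omega)
  have hle := sum_odd_one_div_le_oddTotientInvSum N
  linarith

/-- The odd positive integers up to `t`, each counted with the product of `1 + w p` over its
divisors `p ∈ P`. -/
def weightedOddCount (w : ℕ → ℝ) (P : Finset ℕ) (t : ℝ) : ℝ :=
  ∑ m ∈ Icc 1 ⌊t⌋₊ with Odd m, ∏ p ∈ P with p ∣ m, (1 + w p)

theorem card_odd_Icc (n : ℕ) : #{m ∈ Icc 1 n | Odd m} = (n + 1) / 2 := by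
  induction n with
  | zero => rfl
  | succ n ih =>
    rw [← insert_Icc_right_eq_Icc_add_one (by omega), filter_insert]
    split_ifs with h
    · have := Nat.odd_iff.mp h
      rw [card_insert_of_notMem (by simp), ih]
      omega
    · have := Nat.odd_iff.not.mp h
      rw [ih]
      omega

theorem weightedOddCount_empty_le (w : ℕ → ℝ) {t : ℝ} (ht : 0 ≤ t) :
    weightedOddCount w ∅ t ≤ t / 2 + √t / 2 := by
  simp only [weightedOddCount, filter_empty, prod_empty, sum_const, nsmul_eq_mul, mul_one,
    card_odd_Icc]
  rcases lt_or_ge t 1 with h | h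
  · rw [Nat.floor_eq_zero.mpr h]
    simp only [zero_add, Nat.reduceDiv, Nat.cast_zero]
    positivity
  · have hdiv : (((⌊t⌋₊ + 1) / 2 : ℕ) : ℝ) ≤ ((⌊t⌋₊ + 1 : ℕ) : ℝ) / 2 :=
      mod_cast Nat.cast_div_le (m := ⌊t⌋₊ + 1) (n := 2) (α := ℝ)
    have hfloor := Nat.floor_le ht
    have hsqrt : 1 ≤ √t := Real.one_le_sqrt.mpr h
    push_cast at hdiv
    linarith

theorem sum_dvd_le_weightedOddCount_div {w : ℕ → ℝ} (hw : ∀ p, p.Prime → 0 ≤ w p)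
    {P : Finset ℕ} (hP : ∀ p ∈ P, p.Prime) {q : ℕ} (hq : q.Prime) (hqP : q ∉ P) {t : ℝ}
    (ht : 0 ≤ t) :
    ∑ m ∈ {m ∈ Icc 1 ⌊t⌋₊ | Odd m} with q ∣ m, ∏ p ∈ P with p ∣ m, (1 + w p) ≤
      weightedOddCount w P (t / q) := by
  have hq0 : (0 : ℝ) < q := by exact_mod_cast hq.pos
  have hsub : {m ∈ {m ∈ Icc 1 ⌊t⌋₊ | Odd m} | q ∣ m} ⊆
      {r ∈ Icc 1 ⌊t / q⌋₊ | Odd r}.image (q * ·) := by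
    intro m hm
    simp only [mem_filter, mem_Icc, mem_image] at hm ⊢
    obtain ⟨⟨⟨hm1, hmt⟩, hodd⟩, ⟨r, rfl⟩⟩ := hm
    refine ⟨r, ⟨⟨Nat.pos_of_ne_zero (by rintro rfl; simp at hm1), Nat.le_floor ?_⟩,
      (Nat.odd_mul.mp hodd).2⟩, rfl⟩
    rw [le_div_iff₀ hq0, mul_comm]
    exact_mod_cast (Nat.le_floor_iff ht).mp hmt
  have hnonneg : ∀ m, 0 ≤ ∏ p ∈ P with p ∣ m, (1 + w p) := fun m =>
    prod_nonneg fun p hp => add_nonneg zero_le_one (hw p (hP p (mem_filter.mp hp).1))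
  refine (sum_le_sum_of_subset_of_nonneg hsub fun m _ _ => hnonneg m).trans ?_
  rw [sum_image fun a _ b _ h => Nat.eq_of_mul_eq_mul_left hq.pos h]
  refine le_of_eq (sum_congr rfl fun r _ => prod_congr (filter_congr fun p hp => ?_) fun _ _ => rfl)
  have hpq : ¬ p ∣ q := fun h => hqP ((Nat.prime_dvd_prime_iff_eq (hP p hp) hq).mp h ▸ hp)
  rw [(hP p hp).dvd_mul, or_iff_right hpq]

theorem weightedOddCount_insert_le {w : ℕ → ℝ} (hw : ∀ p, p.Prime → 0 ≤ w p) {P : Finset ℕ}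
    (hP : ∀ p ∈ P, p.Prime) {q : ℕ} (hq : q.Prime) (hqP : q ∉ P) {t : ℝ} (ht : 0 ≤ t) :
    weightedOddCount w (insert q P) t ≤
      weightedOddCount w P t + w q * weightedOddCount w P (t / q) := by
  have hsplit : weightedOddCount w (insert q P) t = weightedOddCount w P t +
      w q * ∑ m ∈ {m ∈ Icc 1 ⌊t⌋₊ | Odd m} with q ∣ m, ∏ p ∈ P with p ∣ m, (1 + w p) := by
    rw [sum_filter _ (fun m => ∏ p ∈ P with p ∣ m, (1 + w p)), mul_sum, weightedOddCount,
      weightedOddCount, ← sum_add_distrib]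
    refine sum_congr rfl fun m _ => ?_
    rw [filter_insert]
    split_ifs
    · rw [prod_insert (fun h => hqP (mem_filter.mp h).1)]
      ring
    · ring
  rw [hsplit]
  have hwq := hw q hq
  gcongr
  exact sum_dvd_le_weightedOddCount_div hw hP hq hqP ht

theorem weightedOddCount_le {w : ℕ → ℝ} (hw : ∀ p, p.Prime → 0 ≤ w p) {P : Finset ℕ}
    (hP : ∀ p ∈ P, p.Prime) {t : ℝ} (ht : 0 ≤ t) :
    weightedOddCount w P t ≤
      t / 2 * ∏ p ∈ P, (1 + w p / p) + √t / 2 * ∏ p ∈ P, (1 + w p / √p) := by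
  induction P using Finset.induction_on generalizing t with
  | empty =>
    simp only [prod_empty, mul_one]
    exact weightedOddCount_empty_le w ht
  | insert q P hqP ih =>
    have hq : q.Prime := hP q (mem_insert_self q P)
    have hP' : ∀ p ∈ P, p.Prime := fun p hp => hP p (mem_insert_of_mem hp)
    have hq0 : (0 : ℝ) < q := by exact_mod_cast hq.pos
    have hwq := hw q hq
    have hdiv := ih hP' (t := t / q) (by positivity)
    rw [Real.sqrt_div ht] at hdiv
    rw [prod_insert hqP, prod_insert hqP]
    calc weightedOddCount w (insert q P) t
        ≤ weightedOddCount w P t + w q * weightedOddCount w P (t / q) :=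
          weightedOddCount_insert_le hw hP' hq hqP ht
      _ ≤ (t / 2 * ∏ p ∈ P, (1 + w p / p) + √t / 2 * ∏ p ∈ P, (1 + w p / √p)) +
            w q * (t / q / 2 * ∏ p ∈ P, (1 + w p / p) +
              √t / √q / 2 * ∏ p ∈ P, (1 + w p / √p)) := by
          gcongr
          exact ih hP' ht
      _ = t / 2 * ((1 + w q / q) * ∏ p ∈ P, (1 + w p / p)) +
            √t / 2 * ((1 + w q / √q) * ∏ p ∈ P, (1 + w p / √p)) := by
          field_simp
          ring

theorem sum_divisors_div_totient {m : ℕ} (hm : Squarefree m) :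
    ((∑ d ∈ m.divisors, d : ℕ) : ℝ) / (m.totient : ℝ) =
      ∏ p ∈ m.primeFactors, (1 + 2 / ((p : ℝ) - 1)) := by
  have hsigma : ∑ d ∈ m.divisors, d = ∏ p ∈ m.primeFactors, (1 + p) := by
    simpa only [ArithmeticFunction.id_apply] using
      (ArithmeticFunction.isMultiplicative_id.prodPrimeFactors_one_add_of_squarefree hm).symm
  have htotient : m.totient = ∏ p ∈ m.primeFactors, (p - 1) := by
    have h := Nat.totient_mul_prod_primeFactors m
    rw [Nat.prod_primeFactors_of_squarefree hm, mul_comm] at h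
    exact Nat.eq_of_mul_eq_mul_left (Nat.pos_of_ne_zero hm.ne_zero) h
  rw [hsigma, htotient]
  push_cast
  rw [← prod_div_distrib]
  refine prod_congr rfl fun p hp => ?_
  have hp := (Nat.prime_of_mem_primeFactors hp).one_lt
  have hp1 : (p : ℝ) - 1 ≠ 0 := (sub_pos.mpr (by exact_mod_cast hp : (1 : ℝ) < p)).ne'
  rw [Nat.cast_sub hp.le, Nat.cast_one]
  field_simp
  ring

theorem two_div_sub_one_nonneg_of_prime {p : ℕ} (hp : p.Prime) : 0 ≤ 2 / ((p : ℝ) - 1) :=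
  div_nonneg zero_le_two (sub_nonneg.mpr (by exact_mod_cast hp.one_lt.le))

theorem oddSigmaTotientSum_le_weightedOddCount (N : ℕ) :
    (oddSigmaTotientSum N : ℝ) ≤
      weightedOddCount (fun p => 2 / ((p : ℝ) - 1)) {p ∈ Icc 1 N | p.Prime ∧ p ≠ 2} N := by
  have hterm : ∀ m ∈ oddSquarefree N, ((∑ d ∈ m.divisors, d : ℕ) : ℝ) / (m.totient : ℝ) =
      ∏ p ∈ {p ∈ Icc 1 N | p.Prime ∧ p ≠ 2} with p ∣ m, (1 + 2 / ((p : ℝ) - 1)) := by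
    intro m hm
    obtain ⟨⟨hm1, hmN⟩, hodd, hsq⟩ := mem_oddSquarefree.mp hm
    rw [sum_divisors_div_totient hsq]
    refine prod_congr ?_ fun _ _ => rfl
    ext p
    simp only [Nat.mem_primeFactors, mem_filter, mem_Icc]
    constructor
    · rintro ⟨hp, hpm, -⟩
      refine ⟨⟨⟨hp.one_lt.le, (Nat.le_of_dvd hm1 hpm).trans hmN⟩, hp, ?_⟩, hpm⟩
      rintro rfl
      exact Nat.not_even_iff_odd.mpr hodd (even_iff_two_dvd.mpr hpm)
    · rintro ⟨⟨-, hp, -⟩, hpm⟩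
      exact ⟨hp, hpm, by omega⟩
  rw [oddSigmaTotientSum, weightedOddCount, Nat.floor_natCast]
  push_cast
  push_cast at hterm
  rw [sum_congr rfl hterm]
  refine sum_le_sum_of_subset_of_nonneg (fun m hm => ?_) fun m _ _ => prod_nonneg fun p hp => ?_
  · obtain ⟨hmN, hodd, -⟩ := mem_oddSquarefree.mp hm
    exact mem_filter.mpr ⟨mem_Icc.mpr hmN, hodd⟩
  · have hp := (mem_filter.mp (mem_filter.mp hp).1).2.1
    exact add_nonneg zero_le_one (two_div_sub_one_nonneg_of_prime hp)

theorem sum_odd_le_of_le_telescope {h u : ℕ → ℝ} {k : ℕ} (P : Finset ℕ)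
    (hP : ∀ j ∈ P, k ≤ j ∧ j % 2 = k % 2) (h0 : ∀ j, k ≤ j → 0 ≤ h j) (hu : ∀ j, k ≤ j → 0 ≤ u j)
    (hle : ∀ j, k ≤ j → h j ≤ u j - u (j + 2)) : ∑ j ∈ P, h j ≤ u k := by
  have hsub : P ⊆ (range (P.sup id + 1)).image fun i => k + 2 * i := by
    intro j hj
    obtain ⟨hkj, hmod⟩ := hP j hj
    have hsup : j ≤ P.sup id := le_sup (f := id) hj
    exact mem_image.mpr ⟨(j - k) / 2, mem_range.mpr (by omega), by omega⟩
  calc ∑ j ∈ P, h j ≤ ∑ j ∈ (range (P.sup id + 1)).image fun i => k + 2 * i, h j := by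
        refine sum_le_sum_of_subset_of_nonneg hsub fun j hj _ => ?_
        obtain ⟨i, -, rfl⟩ := mem_image.mp hj
        exact h0 _ (by omega)
    _ = ∑ i ∈ range (P.sup id + 1), h (k + 2 * i) :=
        sum_image (by intro i _ j _ h; simpa using h)
    _ ≤ ∑ i ∈ range (P.sup id + 1), (u (k + 2 * i) - u (k + 2 * (i + 1))) :=
        sum_le_sum fun i _ => hle _ (by omega)
    _ = u (k + 2 * 0) - u (k + 2 * (P.sup id + 1)) :=
        sum_range_sub' (fun i => u (k + 2 * i)) _
    _ ≤ u k := by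
        have := hu (k + 2 * (P.sup id + 1)) (by omega)
        simp only [mul_zero, add_zero]
        linarith

theorem prod_one_add_odd_primes_lt_eleven_le {h : ℕ → ℝ} (P : Finset ℕ)
    (hP : ∀ p ∈ P, p.Prime ∧ p ≠ 2 ∧ p < 11) (h0 : ∀ j, 3 ≤ j → 0 ≤ h j) :
    ∏ p ∈ P, (1 + h p) ≤ (1 + h 3) * (1 + h 5) * (1 + h 7) := by
  have hsub : P ⊆ ({3, 5, 7} : Finset ℕ) := by
    intro p hp
    obtain ⟨hprime, hp2, hp11⟩ := hP p hp
    interval_cases p <;> revert hprime hp2 <;> decide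
  have hge : ∀ p ∈ ({3, 5, 7} : Finset ℕ), 3 ≤ p := by decide
  calc ∏ p ∈ P, (1 + h p) ≤ ∏ p ∈ ({3, 5, 7} : Finset ℕ), (1 + h p) :=
        prod_le_prod_of_subset_of_one_le hsub
          (fun p hp => add_nonneg zero_le_one (h0 p (hge p (hsub hp))))
          (fun p hp _ => le_add_of_nonneg_right (h0 p (hge p hp)))
    _ = (1 + h 3) * (1 + h 5) * (1 + h 7) := by simp [mul_assoc]

theorem prod_one_add_odd_primes_le {h u : ℕ → ℝ} (P : Finset ℕ)
    (hP : ∀ p ∈ P, p.Prime ∧ p ≠ 2) (h0 : ∀ j, 3 ≤ j → 0 ≤ h j) (hu : ∀ j, 11 ≤ j → 0 ≤ u j)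
    (hle : ∀ j, 11 ≤ j → h j ≤ u j - u (j + 2)) :
    ∏ p ∈ P, (1 + h p) ≤ (1 + h 3) * (1 + h 5) * (1 + h 7) * Real.exp (u 11) := by
  have hnonneg : ∀ p ∈ P, 0 ≤ 1 + h p := fun p hp =>
    add_nonneg zero_le_one (h0 p (lt_of_le_of_ne (hP p hp).1.two_le (hP p hp).2.symm))
  have hsmall : ∏ p ∈ P with p < 11, (1 + h p) ≤ (1 + h 3) * (1 + h 5) * (1 + h 7) :=
    prod_one_add_odd_primes_lt_eleven_le _ (fun p hp => by
      obtain ⟨hpP, hp11⟩ := mem_filter.mp hp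
      exact ⟨(hP p hpP).1, (hP p hpP).2, hp11⟩) h0
  have hlarge : ∑ p ∈ P with ¬ p < 11, h p ≤ u 11 := by
    refine sum_odd_le_of_le_telescope _ (fun p hp => ?_) (fun j hj => h0 j (by omega)) hu hle
    obtain ⟨hpP, hp11⟩ := mem_filter.mp hp
    have := Nat.odd_iff.mp ((hP p hpP).1.odd_of_ne_two (hP p hpP).2)
    omega
  have h3 := h0 3 le_rfl
  have h5 := h0 5 (by norm_num)
  have h7 := h0 7 (by norm_num)
  calc ∏ p ∈ P, (1 + h p)
      = (∏ p ∈ P with p < 11, (1 + h p)) * ∏ p ∈ P with ¬ p < 11, (1 + h p) :=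
        (prod_filter_mul_prod_filter_not P _ _).symm
    _ ≤ (1 + h 3) * (1 + h 5) * (1 + h 7) * ∏ p ∈ P with ¬ p < 11, Real.exp (h p) := by
        refine mul_le_mul hsmall (prod_le_prod (fun p hp => hnonneg p (mem_filter.mp hp).1)
          fun p _ => ?_) (prod_nonneg fun p hp => hnonneg p (mem_filter.mp hp).1) (by positivity)
        rw [add_comm]
        exact Real.add_one_le_exp (h p)
    _ ≤ (1 + h 3) * (1 + h 5) * (1 + h 7) * Real.exp (u 11) := by
        rw [← Real.exp_sum]
        gcongr

theorem exp_one_ninth_le : Real.exp (1 / 9) ≤ 1.1176 := by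
  have hexp := Real.exp_one_lt_d9
  have hpow : Real.exp (1 / 9) ^ 9 = Real.exp 1 := by
    rw [← Real.exp_nat_mul]
    norm_num
  refine le_of_pow_le_pow_left₀ (n := 9) (by norm_num) (by norm_num) ?_
  rw [hpow]
  norm_num at hexp ⊢
  linarith

theorem exp_two_thirds_le : Real.exp (2 / 3) ≤ 1.948 := by
  have hpow : Real.exp (2 / 3) ^ 3 = Real.exp 1 ^ 2 := by
    rw [← Real.exp_nat_mul, ← Real.exp_nat_mul]
    norm_num
  refine le_of_pow_le_pow_left₀ (n := 3) (by norm_num) (by norm_num) ?_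
  rw [hpow]
  calc Real.exp 1 ^ 2 ≤ 2.7182818286 ^ 2 := by
        gcongr
        exact Real.exp_one_lt_d9.le
    _ ≤ 1.948 ^ 3 := by norm_num

theorem prod_one_add_two_div_sub_one_div_le (P : Finset ℕ) (hP : ∀ p ∈ P, p.Prime ∧ p ≠ 2) :
    ∏ p ∈ P, (1 + 2 / ((p : ℝ) - 1) / p) ≤ 1.7174 := by
  have htelescope : ∀ j : ℕ, 11 ≤ j → 2 / ((j : ℝ) - 1) / j ≤
      1 / ((j : ℝ) - 2) - 1 / (((j + 2 : ℕ) : ℝ) - 2) := by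
    intro j hj
    have hj : (11 : ℝ) ≤ j := by exact_mod_cast hj
    have hj2 : (0 : ℝ) < (j : ℝ) - 2 := by linarith
    calc 2 / ((j : ℝ) - 1) / j ≤ 2 / ((j : ℝ) - 2) / j := by
          gcongr
          norm_num
      _ = 1 / ((j : ℝ) - 2) - 1 / (((j + 2 : ℕ) : ℝ) - 2) := by
          push_cast
          rw [add_sub_cancel_right]
          field_simp
          ring
  have h := prod_one_add_odd_primes_le (h := fun p => 2 / ((p : ℝ) - 1) / p)
    (u := fun j => 1 / ((j : ℝ) - 2)) P hP
    (fun j hj => by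
      have : (3 : ℝ) ≤ j := by exact_mod_cast hj
      have : (0 : ℝ) < (j : ℝ) - 1 := by linarith
      positivity)
    (fun j hj => by
      have : (11 : ℝ) ≤ j := by exact_mod_cast hj
      have : (0 : ℝ) < (j : ℝ) - 2 := by linarith
      positivity) htelescope
  refine h.trans ?_
  have hexp := exp_one_ninth_le
  norm_num at hexp ⊢
  linarith

theorem two_div_sub_one_div_sqrt_le {x : ℝ} (hx : 2 < x) :
    2 / (x - 1) / √x ≤ 2 / √(x - 2) - 2 / √x := by
  have hr0 : 0 < √x := Real.sqrt_pos.mpr (by linarith)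
  have hs0 : 0 < √(x - 2) := Real.sqrt_pos.mpr (by linarith)
  have hr2 : √x ^ 2 = x := Real.sq_sqrt (by linarith)
  have hs2 : √(x - 2) ^ 2 = x - 2 := Real.sq_sqrt (by linarith)
  have hsr : √(x - 2) ≤ √x := Real.sqrt_le_sqrt (by linarith)
  have hx1 : x - 1 = (√x ^ 2 + √(x - 2) ^ 2) / 2 := by
    rw [hr2, hs2]
    ring
  generalize √x = r at *
  generalize √(x - 2) = s at *
  have hdiff : (r - s) * (r + s) = 2 := by linarith
  have hkey : 2 * s ≤ (r - s) * (r ^ 2 + s ^ 2) := by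
    have hdefect : (r - s) * (r ^ 2 + s ^ 2) - 2 * s = (r - s) * (r * (r - s)) := by
      rw [← hdiff]
      ring
    have hnonneg : 0 ≤ (r - s) * (r * (r - s)) :=
      mul_nonneg (by linarith) (mul_nonneg hr0.le (by linarith))
    linarith
  rw [hx1, div_div, div_sub_div _ _ hs0.ne' hr0.ne',
    div_le_div_iff₀ (by positivity) (by positivity)]
  calc 2 * (s * r) = r * (2 * s) := by ring
    _ ≤ r * ((r - s) * (r ^ 2 + s ^ 2)) := by gcongr
    _ = (2 * r - s * 2) * ((r ^ 2 + s ^ 2) / 2 * r) := by ring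

theorem prod_one_add_two_div_sub_one_div_sqrt_le (P : Finset ℕ)
    (hP : ∀ p ∈ P, p.Prime ∧ p ≠ 2) : ∏ p ∈ P, (1 + 2 / ((p : ℝ) - 1) / √p) ≤ 4.24 := by
  have htelescope : ∀ j : ℕ, 11 ≤ j → 2 / ((j : ℝ) - 1) / √j ≤
      2 / √((j : ℝ) - 2) - 2 / √(((j + 2 : ℕ) : ℝ) - 2) := by
    intro j hj
    have hj : (11 : ℝ) ≤ j := by exact_mod_cast hj
    push_cast
    rw [add_sub_cancel_right]
    exact two_div_sub_one_div_sqrt_le (by linarith)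
  have h := prod_one_add_odd_primes_le (h := fun p => 2 / ((p : ℝ) - 1) / √p)
    (u := fun j => 2 / √((j : ℝ) - 2)) P hP
    (fun j hj => by
      have : (3 : ℝ) ≤ j := by exact_mod_cast hj
      have : (0 : ℝ) < (j : ℝ) - 1 := by linarith
      positivity)
    (fun j _ => by positivity) htelescope
  refine h.trans ?_
  have h3 : (1.732 : ℝ) ≤ √3 := Real.le_sqrt_of_sq_le (by norm_num)
  have h5 : (2.236 : ℝ) ≤ √5 := Real.le_sqrt_of_sq_le (by norm_num)
  have h7 : (2.645 : ℝ) ≤ √7 := Real.le_sqrt_of_sq_le (by norm_num)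
  have h9 : √((11 : ℕ) - 2 : ℝ) = 3 := by
    rw [show ((11 : ℕ) - 2 : ℝ) = 3 ^ 2 by norm_num, Real.sqrt_sq (by norm_num)]
  have hexp := exp_two_thirds_le
  rw [h9]
  push_cast
  calc (1 + 2 / (3 - 1) / √3) * (1 + 2 / (5 - 1) / √5) * (1 + 2 / (7 - 1) / √7) * Real.exp (2 / 3)
      ≤ (1 + 2 / (3 - 1) / 1.732) * (1 + 2 / (5 - 1) / 2.236) * (1 + 2 / (7 - 1) / 2.645) *
          1.948 := by
        have : (0 : ℝ) < 3 - 1 := by norm_num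
        have : (0 : ℝ) < 5 - 1 := by norm_num
        have : (0 : ℝ) < 7 - 1 := by norm_num
        gcongr
    _ ≤ 4.24 := by norm_num

theorem oddSigmaTotientSum_le_of_large {N : ℕ} (hN : 240 ≤ N) :
    (oddSigmaTotientSum N : ℝ) ≤ N := by
  set P := {p ∈ Icc 1 N | p.Prime ∧ p ≠ 2}
  have hP : ∀ p ∈ P, p.Prime ∧ p ≠ 2 := fun p hp => (mem_filter.mp hp).2
  have hN : (240 : ℝ) ≤ N := by exact_mod_cast hN
  have hsqrt : 15.49 ≤ √(N : ℝ) := Real.le_sqrt_of_sq_le (by norm_num; linarith)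
  have hsq : √(N : ℝ) * √N = N := Real.mul_self_sqrt (by linarith)
  calc (oddSigmaTotientSum N : ℝ) ≤ weightedOddCount (fun p => 2 / ((p : ℝ) - 1)) P N :=
        oddSigmaTotientSum_le_weightedOddCount N
    _ ≤ N / 2 * ∏ p ∈ P, (1 + 2 / ((p : ℝ) - 1) / p) +
          √N / 2 * ∏ p ∈ P, (1 + 2 / ((p : ℝ) - 1) / √p) :=
        weightedOddCount_le (fun p hp => two_div_sub_one_nonneg_of_prime hp)
          (fun p hp => (hP p hp).1) (Nat.cast_nonneg N)
    _ ≤ N / 2 * 1.7174 + √N / 2 * 4.24 := by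
        gcongr
        · exact prod_one_add_two_div_sub_one_div_le P hP
        · exact prod_one_add_two_div_sub_one_div_sqrt_le P hP
    _ ≤ N := by nlinarith

theorem oddSigmaTotientSum_mono : Monotone oddSigmaTotientSum := fun _ _ h =>
  sum_le_sum_of_subset_of_nonneg (oddSquarefree_mono h) fun _ _ _ => by positivity

theorem oddSigmaTotientSum_le {N : ℕ} (hN : 15 ≤ N) : (oddSigmaTotientSum N : ℝ) ≤ N := by
  have hblock : ∀ {a b : ℕ}, a ≤ N → N ≤ b → oddSigmaTotientSum b ≤ a →
      (oddSigmaTotientSum N : ℝ) ≤ N := by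
    intro a b ha hb h
    have haN : (a : ℚ) ≤ N := by exact_mod_cast ha
    exact_mod_cast ((oddSigmaTotientSum_mono hb).trans h).trans haN
  rcases le_or_gt N 20 with h20 | h20
  · exact hblock hN h20 (by decide +kernel)
  rcases le_or_gt N 32 with h32 | h32
  · exact hblock h20.le h32 (by decide +kernel)
  rcases le_or_gt N 50 with h50 | h50
  · exact hblock h32.le h50 (by decide +kernel)
  rcases le_or_gt N 82 with h82 | h82
  · exact hblock h50.le h82 (by decide +kernel)
  rcases le_or_gt N 130 with h130 | h130
  · exact hblock h82.le h130 (by decide +kernel)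
  rcases le_or_gt N 212 with h212 | h212
  · exact hblock h130.le h212 (by decide +kernel)
  rcases le_or_gt N 240 with h240 | h240
  · exact hblock h212.le h240 (by decide +kernel)
  · exact oddSigmaTotientSum_le_of_large h240.le

/-- The bound that Selberg's sieve of level `N²` by the odd primes up to `N` gives for the number
of odd primes in an interval of length `y`. -/
def selbergBound (N : ℕ) (y : ℝ) : ℝ :=
  y / (2 * oddTotientInvSum N) + (oddSigmaTotientSum N / oddTotientInvSum N) ^ 2

theorem log_half_le_of_le_two_pow {y : ℝ} (hy : 0 < y) (n : ℕ) (hn : y / 2 ≤ 2 ^ n) :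
    Real.log (y / 2) ≤ n * Real.log 2 := by
  rw [← Real.log_pow]
  exact Real.log_le_log (by linarith) hn

theorem selbergBound_one_le {y : ℝ} (hy : 2 < y) (hy60 : y ≤ 60) :
    selbergBound 1 y ≤ 2 * y / Real.log (y / 2) := by
  have hS : oddTotientInvSum 1 = 1 := by decide +kernel
  have hH : oddSigmaTotientSum 1 = 1 := by decide +kernel
  have hlog2 := Real.log_two_lt_d9
  rw [selbergBound, hS, hH, le_div_iff₀ (Real.log_pos (by linarith))]
  rcases le_or_gt y 4 with h4 | h4
  · have := log_half_le_of_le_two_pow (y := y) (by linarith) 1 (by norm_num; linarith)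
    norm_num at this ⊢
    nlinarith
  rcases le_or_gt y 16 with h16 | h16
  · have := log_half_le_of_le_two_pow (y := y) (by linarith) 3 (by norm_num; linarith)
    norm_num at this ⊢
    nlinarith
  · have := log_half_le_of_le_two_pow (y := y) (by linarith) 5 (by norm_num; linarith)
    norm_num at this ⊢
    nlinarith

theorem selbergBound_seven_le {y : ℝ} (hy60 : 60 < y) (hy1800 : y ≤ 1800) :
    selbergBound 7 y ≤ 2 * y / Real.log (y / 2) := by
  have hS : oddTotientInvSum 7 = 23 / 12 := by decide +kernel
  have hH : oddSigmaTotientSum 7 = 35 / 6 := by decide +kernel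
  have hlog2 := Real.log_two_lt_d9
  have hbound : selbergBound 7 y = 6 / 23 * y + 4900 / 529 := by
    rw [selbergBound, hS, hH]
    push_cast
    ring
  have hreduce : ∀ K : ℝ, Real.log (y / 2) ≤ K → (6 / 23 * y + 4900 / 529) * K ≤ 2 * y →
      (6 / 23 * y + 4900 / 529) * Real.log (y / 2) ≤ 2 * y := by
    intro K hK hKy
    refine le_trans ?_ hKy
    gcongr
  rw [hbound, le_div_iff₀ (Real.log_pos (by linarith))]
  rcases le_or_gt y 128 with h128 | h128
  · have := log_half_le_of_le_two_pow (y := y) (by linarith) 6 (by norm_num; linarith)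
    exact hreduce 4.2 (by norm_num at this ⊢; linarith) (by linarith)
  rcases le_or_gt y 512 with h512 | h512
  · have := log_half_le_of_le_two_pow (y := y) (by linarith) 8 (by norm_num; linarith)
    exact hreduce 5.6 (by norm_num at this ⊢; linarith) (by linarith)
  · have := log_half_le_of_le_two_pow (y := y) (by linarith) 10 (by norm_num; linarith)
    exact hreduce 6.94 (by norm_num at this ⊢; linarith) (by linarith)

theorem selbergBound_floor_sqrt_le {y : ℝ} (hy : 1800 < y) :
    selbergBound ⌊√(y / 8)⌋₊ y ≤ 2 * y / Real.log (y / 2) := by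
  have hlog : 0 < Real.log (y / 2) := Real.log_pos (by linarith)
  set Q := √(y / 8)
  set l := Real.log (y / 2)
  have hQ15 : 15 ≤ Q := Real.le_sqrt_of_sq_le (by norm_num; linarith)
  have hQ2 : Q ^ 2 = y / 8 := Real.sq_sqrt (by linarith)
  have hN15 : 15 ≤ ⌊Q⌋₊ := Nat.le_floor (by exact_mod_cast hQ15)
  have hH : (oddSigmaTotientSum ⌊Q⌋₊ : ℝ) ≤ Q :=
    (oddSigmaTotientSum_le hN15).trans (Nat.floor_le (by linarith))
  have hH0 : (0 : ℝ) ≤ oddSigmaTotientSum ⌊Q⌋₊ := by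
    exact_mod_cast sum_nonneg fun _ _ => by positivity
  have hS : (l + 1) / 4 ≤ oddTotientInvSum ⌊Q⌋₊ := by
    have hfloor : Real.log (2 * Q) ≤ Real.log (2 * (⌊Q⌋₊ + 1)) :=
      Real.log_le_log (by linarith) (by linarith [Nat.lt_floor_add_one Q])
    have hsq : l = 2 * Real.log (2 * Q) := by
      rw [← Nat.cast_ofNat (n := 2), ← Real.log_pow, Nat.cast_ofNat, mul_pow, hQ2]
      exact congrArg Real.log (by ring)
    linarith [half_log_add_quarter_le_oddTotientInvSum hN15]
  have hratio : (0 : ℝ) ≤ oddSigmaTotientSum ⌊Q⌋₊ / oddTotientInvSum ⌊Q⌋₊ :=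
    div_nonneg hH0 (by linarith)
  calc y / (2 * oddTotientInvSum ⌊Q⌋₊) +
        (oddSigmaTotientSum ⌊Q⌋₊ / oddTotientInvSum ⌊Q⌋₊ : ℝ) ^ 2
      ≤ y / (2 * ((l + 1) / 4)) + (Q / ((l + 1) / 4)) ^ 2 := by gcongr
    _ = 2 * y * ((l + 2) / (l + 1) ^ 2) := by
        rw [div_pow, hQ2]
        field_simp
        ring
    _ ≤ 2 * y * (1 / l) := by
        gcongr 2 * y * ?_
        rw [div_le_div_iff₀ (by positivity) hlog]
        nlinarith
    _ = 2 * y / l := by ring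

theorem exists_selbergBound_le {y : ℝ} (hy : 2 < y) :
    ∃ N : ℕ, 1 ≤ N ∧ ((N : ℝ) ≤ 7 ∨ (N : ℝ) ≤ √y) ∧
      selbergBound N y ≤ 2 * y / Real.log (y / 2) := by
  rcases le_or_gt y 60 with h60 | h60
  · exact ⟨1, le_rfl, Or.inl (by norm_num), selbergBound_one_le hy h60⟩
  rcases le_or_gt y 1800 with h1800 | h1800
  · exact ⟨7, by norm_num, Or.inl (by norm_num), selbergBound_seven_le h60 h1800⟩
  · have hQ : 1 ≤ √(y / 8) := Real.le_sqrt_of_sq_le (by linarith)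
    exact ⟨⌊√(y / 8)⌋₊, Nat.le_floor (by exact_mod_cast hQ),
      Or.inr ((Nat.floor_le (by positivity)).trans (Real.sqrt_le_sqrt (by linarith))),
      selbergBound_floor_sqrt_le h1800⟩

end OddSquarefree

section OddPrimeSieve

open ArithmeticFunction BoundingSieve Finset
open scoped ArithmeticFunction.zeta

/-- The product of the odd primes up to `N`. -/
def oddPrimorial (N : ℕ) : ℕ :=
  ∏ p ∈ Icc 1 N with p.Prime ∧ p ≠ 2, p

theorem prime_dvd_oddPrimorial_iff {N p : ℕ} (hp : p.Prime) :
    p ∣ oddPrimorial N ↔ p ≤ N ∧ p ≠ 2 := by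
  rw [oddPrimorial, hp.prime.dvd_finsetProd_iff]
  simp only [mem_filter, mem_Icc]
  constructor
  · rintro ⟨q, ⟨⟨-, hqN⟩, hq, hq2⟩, hpq⟩
    rw [(Nat.prime_dvd_prime_iff_eq hp hq).mp hpq]
    exact ⟨hqN, hq2⟩
  · rintro ⟨hpN, hp2⟩
    exact ⟨p, ⟨⟨hp.one_lt.le, hpN⟩, hp, hp2⟩, dvd_rfl⟩

theorem squarefree_oddPrimorial (N : ℕ) : Squarefree (oddPrimorial N) := by
  refine squarefree_prod_of_pairwise_isCoprime (fun p hp q hq hpq => ?_)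
    fun p hp => (mem_filter.mp hp).2.1.squarefree
  exact Nat.coprime_iff_isRelPrime.mp ((Nat.coprime_primes (mem_filter.mp hp).2.1
    (mem_filter.mp hq).2.1).mpr hpq)

theorem odd_of_dvd_oddPrimorial {N d : ℕ} (hd : d ∣ oddPrimorial N) : Odd d := by
  rw [← Nat.not_even_iff_odd, even_iff_two_dvd]
  exact fun h2 => ((prime_dvd_oddPrimorial_iff Nat.prime_two).mp (h2.trans hd)).2 rfl

theorem mem_oddSquarefree_iff_dvd_oddPrimorial {N k : ℕ} :
    k ∈ oddSquarefree N ↔ k ∣ oddPrimorial N ∧ k ≤ N := by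
  rw [mem_oddSquarefree]
  constructor
  · rintro ⟨⟨hk1, hkN⟩, hodd, hsq⟩
    refine ⟨?_, hkN⟩
    rw [← Nat.prod_primeFactors_of_squarefree hsq]
    refine prod_dvd_prod_of_subset _ _ _ fun p hp => ?_
    have hprime := Nat.prime_of_mem_primeFactors hp
    have hpk := Nat.dvd_of_mem_primeFactors hp
    refine mem_filter.mpr ⟨mem_Icc.mpr ⟨hprime.one_lt.le, (Nat.le_of_dvd hk1 hpk).trans hkN⟩,
      hprime, ?_⟩
    rintro rfl
    exact Nat.not_even_iff_odd.mpr hodd (even_iff_two_dvd.mpr hpk)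
  · rintro ⟨hk, hkN⟩
    have hsq := (squarefree_oddPrimorial N).squarefree_of_dvd hk
    exact ⟨⟨Nat.pos_of_ne_zero hsq.ne_zero, hkN⟩, odd_of_dvd_oddPrimorial hk, hsq⟩

/-- Selberg's sieve of level `N²` by the odd primes up to `N`, for weights on `A` equidistributed
with density `1 / d` in the multiples of each odd `d`. -/
def oddPrimeSieve (A : Finset ℕ) {w : ℕ → ℝ} (hw : ∀ n, 0 ≤ w n) (X : ℝ) {N : ℕ} (hN : 1 ≤ N) :
    SelbergSieve where
  support := A
  prodPrimes := oddPrimorial N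
  prodPrimes_squarefree := squarefree_oddPrimorial N
  weights := w
  weights_nonneg := hw
  totalMass := X
  nu := (ζ : ArithmeticFunction ℝ).pdiv (ArithmeticFunction.id : ArithmeticFunction ℝ)
  nu_mult := isMultiplicative_zeta.natCast.pdiv isMultiplicative_id.natCast
  nu_pos_of_prime p hp _ := by
    have : (0 : ℝ) < p := by exact_mod_cast hp.pos
    simpa [hp.ne_zero] using this
  nu_lt_one_of_prime p hp _ := by
    have : (1 : ℝ) < p := by exact_mod_cast hp.one_lt
    simpa [hp.ne_zero] using inv_lt_one_of_one_lt₀ this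
  level := N ^ 2
  one_le_level := one_le_pow₀ (by exact_mod_cast hN)

section

variable {A : Finset ℕ} {w : ℕ → ℝ} {hw : ∀ n, 0 ≤ w n} {X : ℝ} {N : ℕ} {hN : 1 ≤ N}

theorem oddPrimeSieve_nu {d : ℕ} : (oddPrimeSieve A hw X hN).nu d = (d : ℝ)⁻¹ := by
  rcases eq_or_ne d 0 with rfl | hd
  · simp
  · simp [oddPrimeSieve, hd]

theorem selbergTerms_oddPrimeSieve (k : ℕ) :
    (oddPrimeSieve A hw X hN).selbergTerms k = 1 / k.totient := by
  rw [selbergTerms_apply]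
  simp only [oddPrimeSieve_nu]
  rw [totient_eq_mul_prod_one_sub_inv, prod_inv_distrib, one_div, mul_inv]

theorem selbergDivisors_oddPrimeSieve :
    selbergDivisors (oddPrimeSieve A hw X hN) = oddSquarefree N := by
  ext k
  have hsq : (k : ℝ) ^ 2 ≤ (N : ℝ) ^ 2 ↔ k ≤ N := by
    rw [sq_le_sq₀ (by positivity) (by positivity), Nat.cast_le]
  rw [mem_oddSquarefree_iff_dvd_oddPrimorial, selbergDivisors, mem_filter, Nat.mem_divisors,
    and_iff_left prodPrimes_ne_zero]
  exact and_congr_right fun _ => hsq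

theorem selbergMass_oddPrimeSieve :
    selbergMass (oddPrimeSieve A hw X hN) = oddTotientInvSum N := by
  rw [selbergMass, selbergDivisors_oddPrimeSieve, oddTotientInvSum]
  push_cast
  exact sum_congr rfl fun k _ => selbergTerms_oddPrimeSieve k

theorem selbergDivisorMass_oddPrimeSieve :
    selbergDivisorMass (oddPrimeSieve A hw X hN) = oddSigmaTotientSum N := by
  rw [selbergDivisorMass, selbergDivisors_oddPrimeSieve, oddSigmaTotientSum]
  push_cast
  refine sum_congr rfl fun k _ => ?_
  simp only [selbergTerms_oddPrimeSieve, oddPrimeSieve_nu, inv_inv]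
  ring

theorem sum_primes_le_siftedSum_oddPrimeSieve (hA : ∀ p ∈ A, p.Prime → N < p) :
    ∑ p ∈ A with p.Prime, w p ≤ (oddPrimeSieve A hw X hN).siftedSum := by
  have hcoprime : ∀ p ∈ A, p.Prime → (oddPrimorial N).Coprime p := fun p hpA hp =>
    ((hp.coprime_iff_not_dvd).mpr fun h =>
      absurd ((prime_dvd_oddPrimorial_iff hp).mp h).1 (hA p hpA hp).not_ge).symm
  rw [siftedSum, ← sum_filter]
  exact sum_le_sum_of_subset_of_nonneg
    (fun p hp => mem_filter.mpr ⟨(mem_filter.mp hp).1,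
      hcoprime p (mem_filter.mp hp).1 (mem_filter.mp hp).2⟩) fun n _ _ => hw n

end

theorem sum_primes_le_of_abs_sum_dvd_sub_le {A : Finset ℕ} {w : ℕ → ℝ} (hw : ∀ n, 0 ≤ w n)
    {X M : ℝ} {N : ℕ} (hN : 1 ≤ N) (hA : ∀ p ∈ A, p.Prime → N < p)
    (hM : ∀ d : ℕ, Odd d → |∑ n ∈ A with d ∣ n, w n - X / d| ≤ M) :
    ∑ p ∈ A with p.Prime, w p ≤
      X / oddTotientInvSum N + M * (oddSigmaTotientSum N / oddTotientInvSum N) ^ 2 := by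
  rw [← selbergMass_oddPrimeSieve (A := A) (hw := hw) (X := X) (hN := hN),
    ← selbergDivisorMass_oddPrimeSieve (A := A) (hw := hw) (X := X) (hN := hN)]
  refine (sum_primes_le_siftedSum_oddPrimeSieve hA).trans
    (siftedSum_le_of_abs_rem_le fun d hd => ?_)
  rw [BoundingSieve.rem, oddPrimeSieve_nu, inv_mul_eq_div, BoundingSieve.multSum, ← sum_filter]
  exact hM d (odd_of_dvd_oddPrimorial hd)

theorem odd_and_dvd_iff_modEq {d n : ℕ} (hd : Odd d) :
    Odd n ∧ d ∣ n ↔ (n : ℤ) ≡ d [ZMOD (2 * d : ℕ)] := by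
  rw [Int.natCast_modEq_iff]
  constructor
  · rintro ⟨hn, k, rfl⟩
    have hk : k ≡ 1 [MOD 2] := Nat.odd_iff.mp (Nat.odd_mul.mp hn).2
    simpa [mul_comm] using hk.mul_left' d
  · intro h
    have hdvd : d ∣ n := ((h.of_dvd (Dvd.intro_left 2 rfl)).dvd_iff dvd_rfl).mpr dvd_rfl
    have hd2 : d ≡ 1 [MOD 2] := Nat.odd_iff.mp hd
    exact ⟨Nat.odd_iff.mpr ((h.of_dvd (Dvd.intro d rfl)).trans hd2), hdvd⟩

theorem sum_odd_dvd_eq_sum_modEq (f : ℝ → ℝ) {a b : ℝ} (ha : 0 < a) {d : ℕ} (hd : Odd d) :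
    ∑ n ∈ {n ∈ Icc ⌈a⌉₊ ⌊b⌋₊ | Odd n} with d ∣ n, f n =
      ∑ n ∈ Icc ⌈a⌉ ⌊b⌋ with n ≡ d [ZMOD (2 * d : ℕ)], f n := by
  have hmem : ∀ n : ℕ, n ∈ Icc ⌈a⌉₊ ⌊b⌋₊ ↔ (n : ℤ) ∈ Icc ⌈a⌉ ⌊b⌋ := by
    intro n
    rw [mem_Icc, mem_Icc, Int.ceil_le, Int.le_floor, Nat.ceil_le, Int.cast_natCast]
    refine and_congr_right fun han => Nat.le_floor_iff' ?_
    rintro rfl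
    exact ha.not_ge (by simpa using han)
  refine sum_bij (fun n _ => (n : ℤ)) (fun n hn => ?_) (fun m _ n _ h => Int.ofNat.inj h)
    (fun n hn => ?_) fun n _ => by rw [Int.cast_natCast]
  · rw [mem_filter, mem_filter, and_assoc, hmem, odd_and_dvd_iff_modEq hd] at hn
    exact mem_filter.mpr hn
  · have hn0 : 0 ≤ n := by
      have := (Int.ceil_pos.mpr ha).le.trans (mem_Icc.mp (mem_filter.mp hn).1).1
      exact this
    lift n to ℕ using hn0
    refine ⟨n, ?_, rfl⟩
    rw [mem_filter, mem_filter, and_assoc, hmem, odd_and_dvd_iff_modEq hd]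
    exact mem_filter.mp hn

theorem abs_sum_odd_dvd_sub_le {f : ℝ → ℝ} {a b M : ℝ}
    (hf : AntitoneOn f (Set.Icc a b) ∨ MonotoneOn f (Set.Icc a b))
    (hf0 : ∀ t ∈ Set.Icc a b, 0 ≤ f t) (hfM : ∀ t ∈ Set.Icc a b, f t ≤ M) (hab : a ≤ b)
    (ha : 0 < a) {d : ℕ} (hd : Odd d) :
    |∑ n ∈ {n ∈ Icc ⌈a⌉₊ ⌊b⌋₊ | Odd n} with d ∣ n, f n - ((∫ t in a..b, f t) / 2) / d| ≤ M := by
  have hd0 : 0 < 2 * d := by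
    have := hd.pos
    omega
  rw [sum_odd_dvd_eq_sum_modEq f ha hd, div_div]
  rcases hf with hf | hf
  · exact_mod_cast abs_sum_modEq_sub_integral_div_le_of_antitoneOn hf hf0 hfM hab hd0 d
  · exact_mod_cast abs_sum_modEq_sub_integral_div_le_of_monotoneOn hf hf0 hfM hab hd0 d

theorem sum_primes_le_integral_div_add {f : ℝ → ℝ} {a b M : ℝ}
    (hf : AntitoneOn f (Set.Icc a b) ∨ MonotoneOn f (Set.Icc a b))
    (hf0 : ∀ t ∈ Set.Icc a b, 0 ≤ f t) (hfM : ∀ t ∈ Set.Icc a b, f t ≤ M) (hab : a ≤ b)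
    (ha : 2 < a) {N : ℕ} (hN : 1 ≤ N) (hNa : (N : ℝ) < a) :
    ∑ p ∈ Icc ⌈a⌉₊ ⌊b⌋₊ with p.Prime, f p ≤
      ((∫ t in a..b, f t) / 2) / oddTotientInvSum N +
        M * (oddSigmaTotientSum N / oddTotientInvSum N) ^ 2 := by
  set A := {n ∈ Icc ⌈a⌉₊ ⌊b⌋₊ | Odd n}
  have hmem : ∀ n ∈ Icc ⌈a⌉₊ ⌊b⌋₊, (n : ℝ) ∈ Set.Icc a b := fun n hn =>
    ⟨Nat.ceil_le.mp (mem_Icc.mp hn).1, (Nat.le_floor_iff (by linarith)).mp (mem_Icc.mp hn).2⟩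
  have habs : ∀ n ∈ A, |f n| = f n := fun n hn =>
    abs_of_nonneg (hf0 _ (hmem n (mem_filter.mp hn).1))
  have hdisc : ∀ d : ℕ, Odd d →
      |∑ n ∈ A with d ∣ n, |f n| - ((∫ t in a..b, f t) / 2) / d| ≤ M := fun d hd => by
    rw [sum_congr rfl fun n hn => habs n (mem_filter.mp hn).1]
    exact abs_sum_odd_dvd_sub_le hf hf0 hfM hab (by linarith) hd
  have hodd : {p ∈ Icc ⌈a⌉₊ ⌊b⌋₊ | p.Prime} ⊆ {p ∈ A | p.Prime} := fun p hp => by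
    obtain ⟨hpI, hprime⟩ := mem_filter.mp hp
    have hp2 : p ≠ 2 := by
      rintro rfl
      have := (hmem 2 hpI).1
      norm_num at this
      linarith
    exact mem_filter.mpr ⟨mem_filter.mpr ⟨hpI, hprime.odd_of_ne_two hp2⟩, hprime⟩
  calc ∑ p ∈ Icc ⌈a⌉₊ ⌊b⌋₊ with p.Prime, f p
      ≤ ∑ p ∈ Icc ⌈a⌉₊ ⌊b⌋₊ with p.Prime, |f p| := sum_le_sum fun p _ => le_abs_self _
    _ ≤ ∑ p ∈ A with p.Prime, |f p| :=
        sum_le_sum_of_subset_of_nonneg hodd fun p _ _ => abs_nonneg _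
    _ ≤ ((∫ t in a..b, f t) / 2) / oddTotientInvSum N +
          M * (oddSigmaTotientSum N / oddTotientInvSum N) ^ 2 :=
        sum_primes_le_of_abs_sum_dvd_sub_le (fun n => abs_nonneg _) hN
          (fun p hp _ => by exact_mod_cast hNa.trans_le (hmem p (mem_filter.mp hp).1).1) hdisc

theorem sum_primes_le_two_mul_div_log {f : ℝ → ℝ} {a b M W : ℝ}
    (hf : AntitoneOn f (Set.Icc a b) ∨ MonotoneOn f (Set.Icc a b))
    (hf0 : ∀ t ∈ Set.Icc a b, 0 ≤ f t) (hfM : ∀ t ∈ Set.Icc a b, f t ≤ M) (hab : a ≤ b)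
    (hW : ∫ t in a..b, f t ≤ W) (hM : 0 < M) (hMW : 2 * M < W) (ha : 7 < a) (hWa : √(W / M) < a) :
    ∑ p ∈ Icc ⌈a⌉₊ ⌊b⌋₊ with p.Prime, f p ≤ 2 * W / Real.log (W / (2 * M)) := by
  obtain ⟨N, hN, hNy, hbound⟩ := exists_selbergBound_le ((lt_div_iff₀ hM).mpr hMW)
  have hNa : (N : ℝ) < a := by rcases hNy with h | h <;> linarith
  have hS : (0 : ℝ) ≤ oddTotientInvSum N := by exact_mod_cast sum_nonneg fun _ _ => by positivity
  calc ∑ p ∈ Icc ⌈a⌉₊ ⌊b⌋₊ with p.Prime, f p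
      ≤ ((∫ t in a..b, f t) / 2) / oddTotientInvSum N +
          M * (oddSigmaTotientSum N / oddTotientInvSum N) ^ 2 :=
        sum_primes_le_integral_div_add hf hf0 hfM hab (by linarith) hN hNa
    _ ≤ (W / 2) / oddTotientInvSum N +
          M * (oddSigmaTotientSum N / oddTotientInvSum N) ^ 2 := by gcongr
    _ = M * selbergBound N (W / M) := by
        rw [selbergBound]
        field_simp
    _ ≤ M * (2 * (W / M) / Real.log (W / M / 2)) := by gcongr
    _ = 2 * W / Real.log (W / (2 * M)) := by
        rw [div_div, mul_comm M 2]
        field_simp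

end OddPrimeSieve

section BesselLaplaceTransform

open Finset

theorem hasSum_besselI0 (t : ℝ) :
    HasSum (fun n : ℕ => (t / 2) ^ (2 * n) / (n.factorial : ℝ) ^ 2) (besselI0 t) := by
  refine Summable.hasSum (.of_nonneg_of_le (fun n => by rw [pow_mul]; positivity) (fun n => ?_)
    (Real.summable_pow_div_factorial ((t / 2) ^ 2)))
  have h1 : (1 : ℝ) ≤ n.factorial := by exact_mod_cast n.factorial_pos
  rw [pow_mul]
  gcongr
  exact le_self_pow₀ h1 two_ne_zero

theorem besselI0_nonneg (t : ℝ) : 0 ≤ besselI0 t :=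
  (hasSum_besselI0 t).nonneg fun n => by rw [pow_mul]; positivity

theorem continuous_besselI0 : Continuous besselI0 := by
  refine continuous_iff_continuousAt.mpr fun t₀ => ?_
  have hball : ContinuousOn besselI0 (Metric.ball 0 (|t₀| + 1)) := by
    refine continuousOn_tsum (fun n => by fun_prop) (hasSum_besselI0 (|t₀| + 1)).summable
      fun n t ht => ?_
    rw [mem_ball_zero_iff, Real.norm_eq_abs] at ht
    rw [norm_div, norm_pow, norm_pow, Real.norm_natCast, norm_div, Real.norm_eq_abs,
      Real.norm_two]
    gcongr
  refine hball.continuousAt (Metric.isOpen_ball.mem_nhds ?_)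
  rw [mem_ball_zero_iff, Real.norm_eq_abs]
  exact lt_add_one _

theorem integral_pow_mul_one_sub_sq_pow (n k : ℕ) :
    ∫ s in (-1 : ℝ)..1, s ^ (2 * k) * (1 - s ^ 2) ^ n =
      2 * ((2 * k).factorial : ℝ) * n.factorial * 4 ^ n * (n + k).factorial
        / (k.factorial * (2 * (n + k) + 1).factorial) := by
  induction n generalizing k with
  | zero =>
    simp only [pow_zero, mul_one, integral_pow, Nat.factorial_zero, Nat.cast_one, zero_add]
    rw [Odd.neg_one_pow ⟨k, rfl⟩, Nat.factorial_succ (2 * k)]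
    push_cast
    field_simp
    norm_num
  | succ n ih =>
    have hsplit (s : ℝ) : s ^ (2 * k) * (1 - s ^ 2) ^ (n + 1)
        = s ^ (2 * k) * (1 - s ^ 2) ^ n - s ^ (2 * (k + 1)) * (1 - s ^ 2) ^ n := by ring
    simp_rw [hsplit]
    rw [intervalIntegral.integral_sub (Continuous.intervalIntegrable (by fun_prop) _ _)
      (Continuous.intervalIntegrable (by fun_prop) _ _), ih, ih,
      show n + 1 + k = n + k + 1 by ring, show n + (k + 1) = n + k + 1 by ring,
      show 2 * (k + 1) = 2 * k + 1 + 1 by ring,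
      show 2 * (n + k + 1) + 1 = 2 * (n + k) + 1 + 1 + 1 by ring]
    simp only [Nat.factorial_succ]
    push_cast
    field_simp
    ring

theorem hasSum_sum_antidiagonal {f : ℕ × ℕ → ℝ} {a : ℝ} (hf : HasSum f a) :
    HasSum (fun N => ∑ q ∈ antidiagonal N, f q) a :=
  (HasAntidiagonal.sigmaAntidiagonalEquivProd (A := ℕ)).hasSum_iff.mpr hf |>.sigma
    fun N => (antidiagonal N).hasSum f

theorem hasSum_mul_of_nonneg {f g : ℕ → ℝ} {a b : ℝ} (hf : HasSum f a) (hg : HasSum g b)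
    (hf0 : ∀ n, 0 ≤ f n) (hg0 : ∀ n, 0 ≤ g n) :
    HasSum (fun q : ℕ × ℕ => f q.1 * g q.2) (a * b) :=
  hf.mul hg (hf.summable.mul_of_nonneg hg.summable hf0 hg0)

/-- The terms of the double power series of `s ↦ cosh (a s) I₀(c √(1 - s²))`. -/
def coshBesselTerm (a c : ℝ) (q : ℕ × ℕ) (s : ℝ) : ℝ :=
  (a * s) ^ (2 * q.1) / (2 * q.1).factorial *
    ((c / 2) ^ (2 * q.2) / (q.2.factorial : ℝ) ^ 2 * (1 - s ^ 2) ^ q.2)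

theorem summable_coshBesselCoeff (a c : ℝ) : Summable fun q : ℕ × ℕ =>
    a ^ (2 * q.1) / (2 * q.1).factorial * ((c / 2) ^ (2 * q.2) / (q.2.factorial : ℝ) ^ 2) :=
  (hasSum_mul_of_nonneg (Real.hasSum_cosh a) (hasSum_besselI0 c)
    (fun n => by rw [pow_mul]; positivity) (fun n => by rw [pow_mul]; positivity)).summable

theorem hasSum_coshBesselTerm (a c : ℝ) {s : ℝ} (hs : s ^ 2 ≤ 1) :
    HasSum (fun q => coshBesselTerm a c q s)
      (Real.cosh (a * s) * besselI0 (c * √(1 - s ^ 2))) := by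
  have hs' : 0 ≤ 1 - s ^ 2 := sub_nonneg.mpr hs
  have hbessel : HasSum
      (fun n : ℕ => (c / 2) ^ (2 * n) / (n.factorial : ℝ) ^ 2 * (1 - s ^ 2) ^ n)
      (besselI0 (c * √(1 - s ^ 2))) := by
    convert hasSum_besselI0 (c * √(1 - s ^ 2)) using 2 with n
    rw [mul_div_right_comm, mul_pow, pow_mul √_, Real.sq_sqrt hs', mul_div_right_comm]
  exact hasSum_mul_of_nonneg (Real.hasSum_cosh (a * s)) hbessel
    (fun n => by rw [pow_mul]; positivity) (fun n => by rw [pow_mul]; positivity)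

theorem norm_coshBesselTerm_le (a c : ℝ) (q : ℕ × ℕ) {s : ℝ} (hs : s ^ 2 ≤ 1) :
    ‖coshBesselTerm a c q s‖ ≤
      a ^ (2 * q.1) / (2 * q.1).factorial * ((c / 2) ^ (2 * q.2) / (q.2.factorial : ℝ) ^ 2) := by
  have hs' : 0 ≤ 1 - s ^ 2 := sub_nonneg.mpr hs
  have hpow₁ : (s ^ 2) ^ q.1 ≤ 1 := pow_le_one₀ (sq_nonneg s) hs
  have hpow₂ : (1 - s ^ 2) ^ q.2 ≤ 1 := pow_le_one₀ hs' (sub_le_self _ (sq_nonneg s))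
  rw [coshBesselTerm, mul_pow, pow_mul a, pow_mul s, pow_mul (c / 2), Real.norm_eq_abs,
    abs_of_nonneg (by positivity)]
  gcongr
  · exact mul_le_of_le_one_right (by positivity) hpow₁
  · exact mul_le_of_le_one_right (by positivity) hpow₂

theorem integral_coshBesselTerm (a c : ℝ) (q : ℕ × ℕ) :
    ∫ s in (-1 : ℝ)..1, coshBesselTerm a c q s =
      2 * ((q.1 + q.2).choose q.1 * ((a ^ 2) ^ q.1 * (c ^ 2) ^ q.2))
        / (2 * (q.1 + q.2) + 1).factorial := by
  obtain ⟨k, n⟩ := q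
  have hterm (s : ℝ) : coshBesselTerm a c (k, n) s = a ^ (2 * k) / (2 * k).factorial *
      ((c / 2) ^ (2 * n) / (n.factorial : ℝ) ^ 2) * (s ^ (2 * k) * (1 - s ^ 2) ^ n) := by
    rw [coshBesselTerm]
    ring
  simp_rw [hterm]
  rw [intervalIntegral.integral_const_mul, integral_pow_mul_one_sub_sq_pow,
    Nat.cast_add_choose, pow_mul a, pow_mul (c / 2), div_pow c, div_pow (c ^ 2), add_comm n k,
    show (2 : ℝ) ^ 2 = 4 by norm_num]
  field_simp

theorem sum_antidiagonal_integral_coshBesselTerm (a c : ℝ) (N : ℕ) :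
    ∑ q ∈ antidiagonal N, ∫ s in (-1 : ℝ)..1, coshBesselTerm a c q s =
      2 * (a ^ 2 + c ^ 2) ^ N / (2 * N + 1).factorial := by
  rw [Commute.add_pow' (Commute.all _ _), mul_div_right_comm, mul_sum]
  refine sum_congr rfl fun q hq => ?_
  rw [integral_coshBesselTerm, mem_antidiagonal.mp hq, nsmul_eq_mul]
  ring

theorem integral_cosh_mul_besselI0 {a c : ℝ} (hac : 0 < a ^ 2 + c ^ 2) :
    ∫ s in (-1 : ℝ)..1, Real.cosh (a * s) * besselI0 (c * √(1 - s ^ 2)) =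
      2 * (Real.sinh √(a ^ 2 + c ^ 2) / √(a ^ 2 + c ^ 2)) := by
  have hsq {s : ℝ} (hs : s ∈ Set.uIoc (-1 : ℝ) 1) : s ^ 2 ≤ 1 := by
    rw [Set.uIoc_of_le (by norm_num)] at hs
    nlinarith [hs.1, hs.2]
  have hcont (q : ℕ × ℕ) : Continuous (coshBesselTerm a c q) := by
    unfold coshBesselTerm
    fun_prop
  have hintegral : HasSum (fun q => ∫ s in (-1 : ℝ)..1, coshBesselTerm a c q s)
      (∫ s in (-1 : ℝ)..1, Real.cosh (a * s) * besselI0 (c * √(1 - s ^ 2))) :=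
    intervalIntegral.hasSum_integral_of_dominated_convergence _
      (fun q => (hcont q).aestronglyMeasurable)
      (fun q => .of_forall fun s hs => norm_coshBesselTerm_le a c q (hsq hs))
      (.of_forall fun _ _ => summable_coshBesselCoeff a c) intervalIntegrable_const
      (.of_forall fun s hs => hasSum_coshBesselTerm a c (hsq hs))
  have hsinh : HasSum (fun N : ℕ => 2 * (a ^ 2 + c ^ 2) ^ N / (2 * N + 1).factorial)
      (2 * (Real.sinh √(a ^ 2 + c ^ 2) / √(a ^ 2 + c ^ 2))) := by
    have hr : √(a ^ 2 + c ^ 2) ≠ 0 := (Real.sqrt_pos.mpr hac).ne'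
    refine (((Real.hasSum_sinh √(a ^ 2 + c ^ 2)).div_const √(a ^ 2 + c ^ 2)).mul_left 2).congr_fun
      fun N => ?_
    rw [pow_succ √_, pow_mul √_, Real.sq_sqrt hac.le]
    field_simp
  have hdiagonal := hasSum_sum_antidiagonal hintegral
  simp_rw [sum_antidiagonal_integral_coshBesselTerm] at hdiagonal
  exact hdiagonal.unique hsinh

theorem integral_exp_mul_besselI0 {a c : ℝ} (hac : 0 < a ^ 2 + c ^ 2) :
    ∫ s in (-1 : ℝ)..1, Real.exp (a * s) * besselI0 (c * √(1 - s ^ 2)) =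
      2 * (Real.sinh √(a ^ 2 + c ^ 2) / √(a ^ 2 + c ^ 2)) := by
  have hint (b : ℝ) : IntervalIntegrable
      (fun s => Real.exp (b * s) * besselI0 (c * √(1 - s ^ 2))) MeasureTheory.volume (-1) 1 :=
    (Continuous.mul (by fun_prop) (continuous_besselI0.comp (by fun_prop))).intervalIntegrable _ _
  have hneg : ∫ s in (-1 : ℝ)..1, Real.exp (-a * s) * besselI0 (c * √(1 - s ^ 2))
      = ∫ s in (-1 : ℝ)..1, Real.exp (a * s) * besselI0 (c * √(1 - s ^ 2)) := by
    have h := intervalIntegral.integral_comp_neg (a := -1) (b := 1)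
      (fun s => Real.exp (a * s) * besselI0 (c * √(1 - s ^ 2)))
    simpa only [neg_sq, neg_mul, mul_neg, neg_neg] using h
  have hcosh (s : ℝ) : Real.cosh (a * s) * besselI0 (c * √(1 - s ^ 2)) =
      (Real.exp (a * s) * besselI0 (c * √(1 - s ^ 2))
        + Real.exp (-a * s) * besselI0 (c * √(1 - s ^ 2))) / 2 := by
    rw [Real.cosh_eq, neg_mul]
    ring
  rw [← integral_cosh_mul_besselI0 hac]
  simp_rw [hcosh]
  rw [intervalIntegral.integral_div, intervalIntegral.integral_add (hint a) (hint (-a)), hneg]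
  ring

theorem complexSinc_eq_of_sq_eq_neg_sq {w : ℂ} {r : ℝ} (hr : r ≠ 0) (hw : w ^ 2 = -(r : ℂ) ^ 2) :
    complexSinc w = ((Real.sinh r / r : ℝ) : ℂ) := by
  have hr' : Complex.I * r ≠ 0 :=
    mul_ne_zero Complex.I_ne_zero (Complex.ofReal_ne_zero.mpr hr)
  have hsinh : Complex.sin (Complex.I * r) / (Complex.I * r) = ((Real.sinh r / r : ℝ) : ℂ) := by
    rw [mul_comm, Complex.sin_mul_I, mul_div_mul_right _ _ Complex.I_ne_zero]
    push_cast
    rfl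
  rw [← neg_one_mul, ← Complex.I_sq, ← mul_pow] at hw
  rcases sq_eq_sq_iff_eq_or_eq_neg.mp hw with rfl | rfl
  · rw [complexSinc, if_neg hr', hsinh]
  · rw [complexSinc, if_neg (neg_ne_zero.mpr hr'), Complex.sin_neg, neg_div_neg_eq, hsinh]

theorem loganLambda_eq {c ε : ℝ} (hcε : 0 < (ε / 2) ^ 2 + c ^ 2) :
    loganLambda c ε = c / Real.sinh c *
      (Real.sinh √((ε / 2) ^ 2 + c ^ 2) / √((ε / 2) ^ 2 + c ^ 2)) := by
  have hr : ((√((ε / 2) ^ 2 + c ^ 2) : ℝ) : ℂ) ^ 2 = (ε / 2) ^ 2 + c ^ 2 := by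
    exact_mod_cast congrArg Complex.ofReal (Real.sq_sqrt hcε.le)
  have hw : (((Complex.I / 2 * ε) ^ 2 - (c : ℂ) ^ 2) ^ (1 / 2 : ℂ)) ^ 2
      = -((√((ε / 2) ^ 2 + c ^ 2) : ℝ) : ℂ) ^ 2 := by
    rw [one_div, ← Nat.cast_ofNat, Complex.cpow_nat_inv_pow _ two_ne_zero, hr, mul_pow, div_pow,
      Complex.I_sq]
    ring
  rw [loganLambda, logan, complexSinc_eq_of_sq_eq_neg_sq (Real.sqrt_pos.mpr hcε).ne' hw,
    ← Complex.ofReal_sinh, ← Complex.ofReal_div, ← Complex.ofReal_mul, Complex.ofReal_re]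

end BesselLaplaceTransform

section LoganKernel

open MeasureTheory Set

theorem chiStar_nonneg {X : Type*} [TopologicalSpace X] (A : Set X) (x : X) :
    0 ≤ chiStar A x := by
  rw [chiStar]
  split_ifs <;> norm_num

theorem chiStar_le_one {X : Type*} [TopologicalSpace X] (A : Set X) (x : X) :
    chiStar A x ≤ 1 := by
  rw [chiStar]
  split_ifs <;> norm_num

theorem chiStar_Icc_of_mem_Ioo {a b t : ℝ} (h : t ∈ Ioo a b) : chiStar (Icc a b) t = 1 := by
  have hab : a ≤ b := (h.1.trans h.2).le
  rw [chiStar, frontier_Icc hab, if_neg, if_pos (Ioo_subset_Icc_self h)]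
  simp only [mem_insert_iff, mem_singleton_iff, not_or]
  exact ⟨h.1.ne', h.2.ne⟩

theorem chiStar_Icc_of_notMem {a b t : ℝ} (hab : a ≤ b) (h : t ∉ Icc a b) :
    chiStar (Icc a b) t = 0 := by
  rw [chiStar, frontier_Icc hab, if_neg, if_neg h]
  simp only [mem_insert_iff, mem_singleton_iff, not_or]
  exact ⟨fun e => h ⟨e.ge, e.le.trans hab⟩, fun e => h ⟨hab.trans e.ge, e.le⟩⟩

theorem chiStar_Icc_eq_of_iff {a b s a' b' s' : ℝ} (hab : a ≤ b) (hab' : a' ≤ b')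
    (h1 : s = a ↔ s' = a') (h2 : s = b ↔ s' = b') (h3 : s ∈ Icc a b ↔ s' ∈ Icc a' b') :
    chiStar (Icc a b) s = chiStar (Icc a' b') s' := by
  simp only [chiStar, frontier_Icc hab, frontier_Icc hab', mem_insert_iff, mem_singleton_iff,
    h1, h2, h3]
  congr

theorem eta_eq_scale (c : ℝ) {ε : ℝ} (hε : 0 < ε) (t : ℝ) :
    eta c ε t = 1 / ε * eta c 1 (t / ε) := by
  have hχ : chiStar (Icc (-ε) ε) t = chiStar (Icc (-1) 1) (t / ε) := by
    refine chiStar_Icc_eq_of_iff (by linarith) (by norm_num) ?_ ?_ ?_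
    · rw [div_eq_iff hε.ne', neg_one_mul]
    · rw [div_eq_iff hε.ne', one_mul]
    · rw [mem_Icc, mem_Icc, le_div_iff₀ hε, div_le_iff₀ hε, neg_one_mul, one_mul]
  rw [eta, eta, hχ, div_one]
  field_simp

theorem eta_nonneg {c ε : ℝ} (hc : 0 < c) (hε : 0 < ε) (t : ℝ) : 0 ≤ eta c ε t := by
  exact mul_nonneg (chiStar_nonneg _ _) (mul_nonneg (by positivity) (besselI0_nonneg _))

theorem eta_neg {c ε : ℝ} (hε : 0 < ε) (t : ℝ) : eta c ε (-t) = eta c ε t := by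
  have hχ : chiStar (Icc (-ε) ε) (-t) = chiStar (Icc (-ε) ε) t := by
    simp only [chiStar, frontier_Icc (show -ε ≤ ε by linarith), mem_insert_iff, mem_singleton_iff,
      mem_Icc]
    refine if_congr ?_ rfl (if_congr ?_ rfl rfl)
    · rw [neg_inj, neg_eq_iff_eq_neg, or_comm]
    · rw [neg_le_neg_iff, neg_le, and_comm]
  rw [eta, eta, hχ, neg_div, neg_sq]

theorem eta_eq_zero {c ε : ℝ} (hε : 0 < ε) {t : ℝ} (ht : t ∉ Icc (-ε) ε) : eta c ε t = 0 := by
  rw [eta, chiStar_Icc_of_notMem (by linarith) ht, zero_mul]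

theorem eta_one_ae_eq (c : ℝ) : eta c 1 =ᵐ[volume] (Icc (-1 : ℝ) 1).indicator
    (fun t => c / (2 * Real.sinh c) * besselI0 (c * √(1 - t ^ 2))) := by
  filter_upwards [volume.ae_ne (-1), volume.ae_ne 1] with t ht1 ht2
  by_cases h : t ∈ Icc (-1 : ℝ) 1
  · rw [indicator_of_mem h, eta, chiStar_Icc_of_mem_Ioo
      ⟨h.1.lt_of_ne' ht1, h.2.lt_of_ne ht2⟩, one_mul, mul_one, div_one]
  · rw [indicator_of_notMem h, eta_eq_zero one_pos h]

theorem continuous_besselI0_sqrt_one_sub_sq (c : ℝ) :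
    Continuous fun t : ℝ => c / (2 * Real.sinh c) * besselI0 (c * √(1 - t ^ 2)) :=
  continuous_const.mul (continuous_besselI0.comp (by fun_prop))

theorem mul_eta_one_ae_eq (c : ℝ) (f : ℝ → ℝ) : (fun t => f t * eta c 1 t) =ᵐ[volume]
    (Icc (-1 : ℝ) 1).indicator
      (fun t => f t * (c / (2 * Real.sinh c) * besselI0 (c * √(1 - t ^ 2)))) := by
  filter_upwards [eta_one_ae_eq c] with t ht
  rw [ht]
  by_cases h : t ∈ Icc (-1 : ℝ) 1 <;> simp [h]

theorem integrable_mul_eta_one (c : ℝ) {f : ℝ → ℝ} (hf : Continuous f) :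
    Integrable fun t => f t * eta c 1 t := by
  rw [integrable_congr (mul_eta_one_ae_eq c f), integrable_indicator_iff measurableSet_Icc]
  exact (hf.mul (continuous_besselI0_sqrt_one_sub_sq c)).continuousOn.integrableOn_compact
    isCompact_Icc

theorem integrable_mul_eta (c : ℝ) {ε : ℝ} (hε : 0 < ε) {f : ℝ → ℝ} (hf : Continuous f) :
    Integrable fun t => f t * eta c ε t := by
  have h := (integrable_mul_eta_one c (f := fun t => f (t * ε)) (by fun_prop)).comp_div hε.ne'
  refine (h.mul_const (1 / ε)).congr (.of_forall fun t => ?_)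
  simp only [div_mul_cancel₀ t hε.ne', eta_eq_scale c hε t]
  ring

theorem integrable_eta (c : ℝ) {ε : ℝ} (hε : 0 < ε) : Integrable (eta c ε) := by
  simpa only [one_mul] using integrable_mul_eta c hε (f := fun _ => 1) continuous_const

theorem integral_exp_mul_eta_one (b : ℝ) {c : ℝ} (hc : 0 < c) :
    ∫ t, Real.exp (b * t) * eta c 1 t =
      c / Real.sinh c * (Real.sinh √(b ^ 2 + c ^ 2) / √(b ^ 2 + c ^ 2)) := by
  rw [integral_congr_ae (mul_eta_one_ae_eq c _), integral_indicator measurableSet_Icc,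
    integral_Icc_eq_integral_Ioc, ← intervalIntegral.integral_of_le (by norm_num)]
  simp_rw [mul_left_comm (Real.exp _)]
  rw [intervalIntegral.integral_const_mul, integral_exp_mul_besselI0 (by positivity)]
  field_simp

theorem integral_eta_one {c : ℝ} (hc : 0 < c) : ∫ t, eta c 1 t = 1 := by
  have h := integral_exp_mul_eta_one 0 hc
  simp only [zero_mul, Real.exp_zero, one_mul, ne_eq, OfNat.ofNat_ne_zero, not_false_eq_true,
    zero_pow, zero_add, Real.sqrt_sq hc.le] at h
  rw [h]
  field_simp

theorem integral_exp_neg_mul_eta {c ε : ℝ} (hc : 0 < c) (hε : 0 < ε) :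
    ∫ t, Real.exp (-t / 2) * eta c ε t = loganLambda c ε := by
  have hscale (t : ℝ) : Real.exp (-t / 2) * eta c ε t
      = 1 / ε * (Real.exp (-(ε / 2) * (t / ε)) * eta c 1 (t / ε)) := by
    rw [eta_eq_scale c hε, show -(ε / 2) * (t / ε) = -t / 2 by field_simp]
    ring
  simp_rw [hscale]
  rw [integral_const_mul,
    Measure.integral_comp_div (fun t => Real.exp (-(ε / 2) * t) * eta c 1 t) ε, abs_of_pos hε,
    smul_eq_mul, integral_exp_mul_eta_one _ hc, neg_sq, loganLambda_eq (by positivity), one_div,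
    inv_mul_cancel_left₀ hε.ne']

/-- The mass of `η_{c,1}` to the right of `s`. It is `(μ_c)_+ (s)` for `s ≥ 0`. -/
def etaTail (c s : ℝ) : ℝ := ∫ τ in Ioi s, eta c 1 τ

theorem integral_Iic_eta_one (c s : ℝ) : ∫ τ in Iic s, eta c 1 τ = etaTail c (-s) := by
  rw [etaTail, ← integral_comp_neg_Iic]
  simp_rw [eta_neg one_pos]

theorem integral_Ioi_eta (c : ℝ) {ε : ℝ} (hε : 0 < ε) (u : ℝ) :
    ∫ τ in Ioi u, eta c ε τ = etaTail c (u / ε) := by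
  have hscale (t : ℝ) : eta c ε t = ε⁻¹ * eta c 1 (ε⁻¹ * t) := by
    rw [eta_eq_scale c hε, one_div, inv_mul_eq_div ε t]
  simp_rw [hscale]
  rw [integral_const_mul, integral_comp_mul_left_Ioi (eta c 1) u (inv_pos.mpr hε), inv_inv,
    smul_eq_mul, inv_mul_cancel_left₀ hε.ne', etaTail, inv_mul_eq_div]

theorem integral_Iic_eta (c : ℝ) {ε : ℝ} (hε : 0 < ε) (u : ℝ) :
    ∫ τ in Iic u, eta c ε τ = etaTail c (-u / ε) := by
  rw [← integral_Ioi_eta c hε, ← integral_comp_neg_Iic]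
  simp_rw [eta_neg hε]

theorem etaTail_nonneg {c : ℝ} (hc : 0 < c) (s : ℝ) : 0 ≤ etaTail c s :=
  setIntegral_nonneg measurableSet_Ioi fun t _ => eta_nonneg hc one_pos t

theorem antitone_etaTail {c : ℝ} (hc : 0 < c) : Antitone (etaTail c) := fun _ _ h =>
  setIntegral_mono_set (integrable_eta c one_pos).integrableOn
    (.of_forall fun t => eta_nonneg hc one_pos t) (Ioi_subset_Ioi h).eventuallyLE

theorem etaTail_eq_zero (c : ℝ) {s : ℝ} (hs : 1 ≤ s) : etaTail c s = 0 :=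
  setIntegral_eq_zero_of_forall_eq_zero fun _ ht =>
    eta_eq_zero one_pos fun h => (hs.trans_lt ht).not_ge h.2

theorem etaTail_add_neg {c : ℝ} (hc : 0 < c) (s : ℝ) : etaTail c (-s) + etaTail c s = 1 := by
  rw [← integral_Iic_eta_one, etaTail, ← compl_Iic,
    integral_add_compl measurableSet_Iic (integrable_eta c one_pos), integral_eta_one hc]

theorem etaTail_zero {c : ℝ} (hc : 0 < c) : etaTail c 0 = 1 / 2 := by
  have h := etaTail_add_neg hc 0
  rw [neg_zero] at h
  linarith

theorem etaTail_eq_intervalIntegral (c s : ℝ) : etaTail c s = ∫ τ in s..1, eta c 1 τ := by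
  have hzero : ∫ τ in Ioi 1, eta c 1 τ = 0 := etaTail_eq_zero c le_rfl
  rw [← intervalIntegral.integral_Ioi_sub_Ioi' (integrable_eta c one_pos).integrableOn
    (integrable_eta c one_pos).integrableOn, hzero, sub_zero, etaTail]

theorem continuous_etaTail (c : ℝ) : Continuous (etaTail c) := by
  have hprimitive : Continuous fun s => ∫ τ in (1 : ℝ)..s, eta c 1 τ :=
    intervalIntegral.continuous_primitive
      (fun a b => (integrable_eta c one_pos).intervalIntegrable) 1
  refine hprimitive.neg.congr fun s => ?_
  rw [etaTail_eq_intervalIntegral, intervalIntegral.integral_symm 1 s, Pi.neg_apply]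

theorem muFun_one_of_pos (c : ℝ) {t : ℝ} (ht : 0 < t) : muFun c 1 t = etaTail c t := by
  rw [muFun, if_neg (by linarith), if_pos ht, integral_Iic_eta_one, neg_neg]

theorem muFun_neg (c ε t : ℝ) : muFun c ε (-t) = -muFun c ε t := by
  rcases lt_trichotomy t 0 with h | h | h
  · rw [muFun, muFun, if_neg (by linarith), if_pos (by linarith), if_pos h, neg_neg, neg_neg]
  · simp [muFun, h]
  · rw [muFun, muFun, if_pos (by linarith), if_neg (by linarith), if_pos h]

theorem rightLim_muFun_one (c : ℝ) {α : ℝ} (hα : 0 ≤ α) :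
    Function.rightLim (muFun c 1) α = etaTail c α := by
  have hlim : Filter.Tendsto (etaTail c) (nhdsWithin α (Ioi α)) (nhds (etaTail c α)) :=
    (continuous_etaTail c).continuousWithinAt
  refine rightLim_eq_of_tendsto (hlim.congr' ?_)
  filter_upwards [self_mem_nhdsWithin] with t ht
  rw [muFun_one_of_pos c (hα.trans_lt ht)]

theorem integrableOn_etaTail_Ioi (c s : ℝ) : IntegrableOn (etaTail c) (Ioi s) := by
  have hIcc : IntegrableOn (etaTail c) (Icc s 1) :=
    (continuous_etaTail c).continuousOn.integrableOn_compact isCompact_Icc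
  refine hIcc.of_forall_sdiff_eq_zero measurableSet_Ioi fun t ht => etaTail_eq_zero c ?_
  by_contra! h
  exact ht.2 ⟨(mem_Ioi.mp ht.1).le, h.le⟩

theorem integral_Ioi_etaTail (c s : ℝ) : ∫ t in Ioi s, etaTail c t = ∫ t in s..1, etaTail c t := by
  rw [← intervalIntegral.integral_Ioi_sub_Ioi' (integrableOn_etaTail_Ioi c s)
    (integrableOn_etaTail_Ioi c 1), setIntegral_eq_zero_of_forall_eq_zero (t := Ioi 1), sub_zero]
  exact fun t ht => etaTail_eq_zero c (mem_Ioi.mp ht).le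

theorem integrable_muFun_one (c : ℝ) : Integrable (muFun c 1) := by
  have hpos : Integrable ((Ioi (0 : ℝ)).indicator (etaTail c)) :=
    (integrable_indicator_iff measurableSet_Ioi).mpr (integrableOn_etaTail_Ioi c 0)
  refine (hpos.sub hpos.comp_neg).congr (.of_forall fun t => ?_)
  simp only [Pi.sub_apply, indicator, mem_Ioi]
  rcases lt_trichotomy t 0 with h | rfl | h
  · rw [if_neg (by linarith), if_pos (by linarith), ← muFun_one_of_pos c (by linarith),
      muFun_neg, zero_sub, neg_neg]
  · simp only [muFun, neg_zero, lt_irrefl, if_false, sub_zero]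
  · rw [if_neg (by linarith : ¬ 0 < -t), if_pos h, muFun_one_of_pos c h, sub_zero]

theorem nuFun_one_eq (c : ℝ) {α : ℝ} (hα : 0 ≤ α) : nuFun c 1 α = -∫ t in α..1, etaTail c t := by
  have htotal : ∫ t, muFun c 1 t = 0 := by
    have h := integral_neg_eq_self (muFun c 1) volume
    simp_rw [muFun_neg] at h
    rw [integral_neg] at h
    linarith
  have hsplit := integral_add_compl (measurableSet_Iic (a := α)) (integrable_muFun_one c)
  rw [compl_Iic, htotal, setIntegral_congr_fun measurableSet_Ioi
    (fun t ht => muFun_one_of_pos c (hα.trans_lt ht)), integral_Ioi_etaTail] at hsplit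
  rw [nuFun]
  linarith

theorem abs_nuFun_one {c : ℝ} (hc : 0 < c) {α : ℝ} (hα₀ : 0 ≤ α) (hα : α ≤ 1) :
    |nuFun c 1 α| = ∫ t in α..1, etaTail c t := by
  rw [nuFun_one_eq c hα₀, abs_neg, abs_of_nonneg]
  exact intervalIntegral.integral_nonneg hα fun t _ => etaTail_nonneg hc t

theorem abs_nuFun_one_le {c : ℝ} (hc : 0 < c) {α : ℝ} (hα₀ : 0 ≤ α) (hα : α ≤ 1) :
    |nuFun c 1 α| ≤ etaTail c α := by
  rw [abs_nuFun_one hc hα₀ hα]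
  calc ∫ t in α..1, etaTail c t ≤ ∫ _ in α..1, etaTail c α :=
        intervalIntegral.integral_mono_on hα ((continuous_etaTail c).intervalIntegrable _ _)
          intervalIntegrable_const fun t ht => antitone_etaTail hc ht.1
    _ = (1 - α) * etaTail c α := by rw [intervalIntegral.integral_const, smul_eq_mul]
    _ ≤ etaTail c α := mul_le_of_le_one_left (etaTail_nonneg hc α) (by linarith)

theorem integral_eta {c ε : ℝ} (hc : 0 < c) (hε : 0 < ε) : ∫ t, eta c ε t = 1 := by
  have h := integral_add_compl (measurableSet_Iic (a := (0 : ℝ))) (integrable_eta c hε)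
  rw [compl_Iic, integral_Iic_eta c hε, integral_Ioi_eta c hε, neg_zero, zero_div,
    etaTail_zero hc] at h
  linarith

theorem integral_mul_eta (c : ℝ) {ε : ℝ} (hε : 0 < ε) : ∫ t, t * eta c ε t = 0 := by
  have h := integral_neg_eq_self (fun t => t * eta c ε t) volume
  simp_rw [eta_neg hε, neg_mul] at h
  rw [integral_neg] at h
  linarith

theorem integrable_exp_mul_eta (c : ℝ) {ε : ℝ} (hε : 0 < ε) :
    Integrable fun s => Real.exp (-s / 2) * eta c ε s :=
  integrable_mul_eta c hε (by fun_prop)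

theorem exp_mul_eta_nonneg {c ε : ℝ} (hc : 0 < c) (hε : 0 < ε) (s : ℝ) :
    0 ≤ Real.exp (-s / 2) * eta c ε s :=
  mul_nonneg (Real.exp_pos _).le (eta_nonneg hc hε s)

theorem one_le_loganLambda {c ε : ℝ} (hc : 0 < c) (hε : 0 < ε) : 1 ≤ loganLambda c ε := by
  have hid := (integrable_mul_eta c hε (f := fun t => t) continuous_id).const_mul (1 / 2)
  rw [← integral_exp_neg_mul_eta hc hε]
  calc (1 : ℝ) = ∫ t, (eta c ε t - 1 / 2 * (t * eta c ε t)) := by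
        rw [integral_sub (integrable_eta c hε) hid, integral_const_mul, integral_mul_eta c hε,
          integral_eta hc hε, mul_zero, sub_zero]
    _ ≤ ∫ t, Real.exp (-t / 2) * eta c ε t := by
        refine integral_mono ((integrable_eta c hε).sub hid) (integrable_exp_mul_eta c hε)
          fun t => ?_
        calc eta c ε t - 1 / 2 * (t * eta c ε t) = (-t / 2 + 1) * eta c ε t := by ring
          _ ≤ Real.exp (-t / 2) * eta c ε t :=
            mul_le_mul_of_nonneg_right (Real.add_one_le_exp _) (eta_nonneg hc hε t)

/-- The smoothed cutoff: `e^{-t/2} φ_{x,c,ε}(t)` as a function of `u = t - log x`. -/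
def etaKernel (c ε u : ℝ) : ℝ :=
  1 / loganLambda c ε * ∫ s in Ioi u, Real.exp (-s / 2) * eta c ε s

theorem integral_indicator_exp_mul_eta (c L : ℝ) {ε t : ℝ} (hε : 0 < ε) (ht : ε ≤ t) :
    ∫ y, (Icc 0 L).indicator (fun s => Real.exp (s / 2)) y * eta c ε (t - y)
      = Real.exp (t / 2) * ∫ s in Ioi (t - L), Real.exp (-s / 2) * eta c ε s := by
  rw [← integral_sub_left_eq_self _ volume t, ← integral_Ici_eq_integral_Ioi,
    ← integral_indicator measurableSet_Ici, ← integral_const_mul]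
  refine integral_congr_ae (.of_forall fun s => ?_)
  simp only [sub_sub_cancel]
  by_cases hs : s ∈ Icc (-ε) ε
  · by_cases hsL : t - L ≤ s
    · rw [indicator_of_mem (show t - s ∈ Icc 0 L from ⟨by linarith [hs.2], by linarith⟩),
        indicator_of_mem (mem_Ici.mpr hsL), ← mul_assoc, ← Real.exp_add]
      ring_nf
    · rw [indicator_of_notMem (show t - s ∉ Icc 0 L from fun h => hsL (by linarith [h.2])),
        indicator_of_notMem (show s ∉ Ici _ from hsL), zero_mul, mul_zero]
  · rw [eta_eq_zero hε hs, mul_zero, indicator_apply, eta_eq_zero hε hs, mul_zero, ite_self,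
      mul_zero]

theorem exp_neg_mul_phiKernel (x c : ℝ) {ε t : ℝ} (hε : 0 < ε) (ht : ε ≤ t) :
    Real.exp (-t / 2) * phiKernel x c ε t = etaKernel c ε (t - Real.log x) := by
  rw [phiKernel, integral_indicator_exp_mul_eta c _ hε ht, etaKernel, mul_left_comm,
    ← mul_assoc (Real.exp _), ← Real.exp_add, neg_div, neg_add_cancel, Real.exp_zero, one_mul]

theorem etaKernel_nonneg {c ε : ℝ} (hc : 0 < c) (hε : 0 < ε) (u : ℝ) : 0 ≤ etaKernel c ε u :=
  mul_nonneg (one_div_nonneg.mpr (zero_le_one.trans (one_le_loganLambda hc hε)))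
    (setIntegral_nonneg measurableSet_Ioi fun s _ => exp_mul_eta_nonneg hc hε s)

theorem one_sub_etaKernel {c ε : ℝ} (hc : 0 < c) (hε : 0 < ε) (u : ℝ) : 1 - etaKernel c ε u =
    1 / loganLambda c ε * ∫ s in Iic u, Real.exp (-s / 2) * eta c ε s := by
  have hlambda : loganLambda c ε ≠ 0 := (zero_lt_one.trans_le (one_le_loganLambda hc hε)).ne'
  have hsplit := integral_add_compl (measurableSet_Iic (a := u)) (integrable_exp_mul_eta c hε)
  rw [compl_Iic, integral_exp_neg_mul_eta hc hε] at hsplit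
  rw [etaKernel, eq_comm, eq_sub_iff_add_eq, ← mul_add, hsplit, one_div_mul_cancel hlambda]

theorem etaKernel_le_one {c ε : ℝ} (hc : 0 < c) (hε : 0 < ε) (u : ℝ) : etaKernel c ε u ≤ 1 := by
  rw [← sub_nonneg, one_sub_etaKernel hc hε]
  exact mul_nonneg (one_div_nonneg.mpr (zero_le_one.trans (one_le_loganLambda hc hε)))
    (setIntegral_nonneg measurableSet_Iic fun s _ => exp_mul_eta_nonneg hc hε s)

theorem one_div_loganLambda_mul_setIntegral_le {c ε : ℝ} (hc : 0 < c) (hε : 0 < ε) {S : Set ℝ}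
    (hS : MeasurableSet S) {C : ℝ} (hC : ∀ s ∈ S, s ∈ Icc (-ε) ε → Real.exp (-s / 2) ≤ C) :
    1 / loganLambda c ε * ∫ s in S, Real.exp (-s / 2) * eta c ε s ≤ C * ∫ s in S, eta c ε s := by
  have hlambda := one_le_loganLambda hc hε
  rw [← integral_const_mul C]
  calc 1 / loganLambda c ε * ∫ s in S, Real.exp (-s / 2) * eta c ε s
      ≤ ∫ s in S, Real.exp (-s / 2) * eta c ε s :=
        mul_le_of_le_one_left (setIntegral_nonneg hS fun s _ => exp_mul_eta_nonneg hc hε s)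
          ((div_le_one (by linarith)).mpr hlambda)
    _ ≤ ∫ s in S, C * eta c ε s := by
        refine setIntegral_mono_on (integrable_exp_mul_eta c hε).integrableOn
          ((integrable_eta c hε).const_mul _).integrableOn hS fun s hs => ?_
        by_cases hsε : s ∈ Icc (-ε) ε
        · exact mul_le_mul_of_nonneg_right (hC s hs hsε) (eta_nonneg hc hε s)
        · rw [eta_eq_zero hε hsε, mul_zero, mul_zero]

theorem one_sub_etaKernel_le {c ε : ℝ} (hc : 0 < c) (hε : 0 < ε) (u : ℝ) :
    1 - etaKernel c ε u ≤ Real.exp (ε / 2) * etaTail c (-u / ε) := by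
  rw [one_sub_etaKernel hc hε, ← integral_Iic_eta c hε]
  refine one_div_loganLambda_mul_setIntegral_le hc hε measurableSet_Iic fun s _ hs => ?_
  exact Real.exp_le_exp.mpr (by linarith [hs.1])

theorem etaKernel_le {c ε : ℝ} (hc : 0 < c) (hε : 0 < ε) {u : ℝ} (hu : 0 ≤ u) :
    etaKernel c ε u ≤ etaTail c (u / ε) := by
  rw [etaKernel, ← integral_Ioi_eta c hε, ← one_mul (∫ τ in Ioi u, eta c ε τ)]
  refine one_div_loganLambda_mul_setIntegral_le hc hε measurableSet_Ioi fun s hs _ => ?_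
  exact Real.exp_le_one_iff.mpr (by linarith [mem_Ioi.mp hs])

theorem etaKernel_eq_zero {c ε u : ℝ} (hc : 0 < c) (hε : 0 < ε) (hu : ε ≤ u) :
    etaKernel c ε u = 0 := by
  refine le_antisymm ((etaKernel_le hc hε (hε.le.trans hu)).trans_eq ?_) (etaKernel_nonneg hc hε u)
  exact etaTail_eq_zero c ((one_le_div hε).mpr hu)

theorem psiMod_eq_tsum_etaKernel (x c : ℝ) {ε : ℝ} (hε₀ : 0 < ε) (hε : ε ≤ Real.log 2) :
    psiMod c ε x = ∑' q : Nat.Primes × ℕ+, Real.log (q.1 : ℝ) *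
      etaKernel c ε (Real.log ((q.1 : ℝ) ^ (q.2 : ℕ)) - Real.log x) := by
  refine tsum_congr fun ⟨p, m⟩ => ?_
  have hp : (2 : ℝ) ≤ (p : ℝ) := by exact_mod_cast p.2.two_le
  have hm : (1 : ℝ) ≤ ((m : ℕ) : ℝ) := by exact_mod_cast m.2
  have hlog : ε ≤ Real.log (p : ℝ) := hε.trans (Real.log_le_log two_pos hp)
  have hεlog : ε ≤ ((m : ℕ) : ℝ) * Real.log (p : ℝ) := by nlinarith
  have hpow : (p : ℝ) ^ (((m : ℕ) : ℝ) / 2) = Real.exp (((m : ℕ) : ℝ) * Real.log (p : ℝ) / 2) := by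
    rw [Real.rpow_def_of_pos (by linarith)]
    ring_nf
  rw [Real.log_pow, ← exp_neg_mul_phiKernel x c hε₀ hεlog, hpow, neg_div, Real.exp_neg,
    div_eq_mul_inv, mul_assoc]

end LoganKernel

section PrimePowers

open Finset

theorem injective_primes_pnat :
    Function.Injective fun q : Nat.Primes × ℕ+ => ((q.1 : ℕ), (q.2 : ℕ)) := by
  rintro ⟨p, m⟩ ⟨p', m'⟩ h
  simp only [Prod.mk.injEq] at h
  exact Prod.ext (Subtype.ext h.1) (PNat.eq h.2)

theorem prime_le_and_exponent_le {p m : ℕ} (hp : p.Prime) (hm : 1 ≤ m) {b : ℝ}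
    (h : (p : ℝ) ^ m ≤ b) : p ≤ ⌊b⌋₊ ∧ m ≤ Nat.log 2 ⌊b⌋₊ := by
  have hpow : p ^ m ≤ ⌊b⌋₊ := Nat.le_floor (by exact_mod_cast h)
  refine ⟨(Nat.le_self_pow (by omega) p).trans hpow, ?_⟩
  exact Nat.le_log_of_pow_le one_lt_two ((Nat.pow_le_pow_left hp.two_le m).trans hpow)

theorem finite_primePow_le (b : ℝ) :
    {q : Nat.Primes × ℕ+ | (q.1 : ℝ) ^ (q.2 : ℕ) ≤ b}.Finite := by
  refine Set.Finite.subset (Set.Finite.preimage injective_primes_pnat.injOn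
    ((Set.finite_Iic ⌊b⌋₊).prod (Set.finite_Iic (Nat.log 2 ⌊b⌋₊)))) fun q hq => ?_
  exact prime_le_and_exponent_le q.1.2 q.2.2 hq

theorem summable_of_primePow_le {f : Nat.Primes × ℕ+ → ℝ} (b : ℝ)
    (hf : ∀ q, b < (q.1 : ℝ) ^ (q.2 : ℕ) → f q = 0) : Summable f := by
  refine summable_of_hasFiniteSupport ((finite_primePow_le b).subset fun q hq => ?_)
  by_contra h
  exact hq (hf q (not_le.mp h))

theorem tsum_primes_pnat_eq_sum {F : ℕ → ℕ → ℝ} {N M : ℕ}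
    (hF : ∀ p m, p.Prime → 1 ≤ m → F p m ≠ 0 → p ≤ N ∧ m ≤ M) :
    ∑' q : Nat.Primes × ℕ+, F q.1 q.2 =
      ∑ m ∈ Icc 1 M, ∑ p ∈ Icc 1 N with p.Prime, F p m := by
  let S : Set (ℕ × ℕ) := {r | r.1.Prime ∧ 1 ≤ r.2}
  let G : ℕ × ℕ → ℝ := S.indicator fun r => F r.1 r.2
  have hG (r : ℕ × ℕ) (hr : r ∈ S) : G r = F r.1 r.2 := Set.indicator_of_mem hr _
  have hreindex : ∑' q : Nat.Primes × ℕ+, F q.1 q.2 = ∑' r, G r := by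
    rw [← injective_primes_pnat.tsum_eq]
    · exact tsum_congr fun q => (hG (q.1, q.2) ⟨q.1.2, q.2.2⟩).symm
    · intro r hr
      have hrS : r ∈ S := Set.mem_of_indicator_ne_zero hr
      exact ⟨(⟨r.1, hrS.1⟩, ⟨r.2, hrS.2⟩), rfl⟩
  rw [hreindex, tsum_eq_sum (s := {p ∈ Icc 1 N | p.Prime} ×ˢ Icc 1 M), sum_product_right]
  · exact sum_congr rfl fun m hm => sum_congr rfl fun p hp =>
      hG _ ⟨(mem_filter.mp hp).2, (mem_Icc.mp hm).1⟩
  · intro r hr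
    by_contra h
    have hrS : r ∈ S := Set.mem_of_indicator_ne_zero h
    rw [hG r hrS] at h
    obtain ⟨hrN, hrM⟩ := hF r.1 r.2 hrS.1 hrS.2 h
    refine hr (mem_product.mpr ⟨mem_filter.mpr ⟨?_, hrS.1⟩, mem_Icc.mpr ⟨hrS.2, hrM⟩⟩)
    exact mem_Icc.mpr ⟨hrS.1.one_lt.le, hrN⟩

theorem card_Icc_ceil_floor_le {a b : ℝ} (hb : 0 ≤ b) (hab : a ≤ b) :
    (#(Icc ⌈a⌉₊ ⌊b⌋₊) : ℝ) ≤ b - a + 1 := by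
  rw [Nat.card_Icc]
  rcases le_total ⌈a⌉₊ (⌊b⌋₊ + 1) with h | h
  · rw [Nat.cast_sub h]
    push_cast
    linarith [Nat.le_ceil a, Nat.floor_le hb]
  · rw [Nat.sub_eq_zero_of_le h, Nat.cast_zero]
    linarith

theorem rpow_inv_sub_rpow_inv_le {a b ε : ℝ} (ha : 0 ≤ a) (hb : 1 ≤ b) (hε : 0 ≤ ε)
    (hba : b ≤ Real.exp ε * a) {m : ℕ} (hm : 2 ≤ m) :
    b ^ (m⁻¹ : ℝ) - a ^ (m⁻¹ : ℝ) ≤ ε * √b / m := by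
  have hroot : b ^ (m⁻¹ : ℝ) ≤ Real.exp (ε / m) * a ^ (m⁻¹ : ℝ) := by
    calc b ^ (m⁻¹ : ℝ) ≤ (Real.exp ε * a) ^ (m⁻¹ : ℝ) := by gcongr
      _ = Real.exp (ε / m) * a ^ (m⁻¹ : ℝ) := by
        rw [Real.mul_rpow (Real.exp_pos _).le ha, ← Real.exp_mul, div_eq_mul_inv]
  have hsqrt : b ^ (m⁻¹ : ℝ) ≤ √b := by
    rw [Real.sqrt_eq_rpow, one_div]
    refine Real.rpow_le_rpow_of_exponent_le hb (inv_anti₀ two_pos ?_)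
    exact_mod_cast hm
  calc b ^ (m⁻¹ : ℝ) - a ^ (m⁻¹ : ℝ)
      ≤ b ^ (m⁻¹ : ℝ) - Real.exp (-(ε / m)) * b ^ (m⁻¹ : ℝ) := by
        gcongr
        rwa [Real.exp_neg, inv_mul_le_iff₀ (Real.exp_pos _)]
    _ = (1 - Real.exp (-(ε / m))) * b ^ (m⁻¹ : ℝ) := by ring
    _ ≤ ε / m * √b := by
        gcongr
        linarith [Real.add_one_le_exp (-(ε / m))]
    _ = ε * √b / m := by ring

theorem card_filter_pow_mem_Icc_le (s : Finset ℕ) {a b ε : ℝ} (ha : 0 ≤ a) (hb : 1 ≤ b)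
    (hab : a ≤ b) (hε : 0 ≤ ε) (hba : b ≤ Real.exp ε * a) {m : ℕ} (hm : 2 ≤ m) :
    (#{n ∈ s | ((n : ℕ) : ℝ) ^ m ∈ Set.Icc a b} : ℝ) ≤ ε * √b / m + 1 := by
  have hb0 : 0 ≤ b := zero_le_one.trans hb
  have hsub : {n ∈ s | ((n : ℕ) : ℝ) ^ m ∈ Set.Icc a b} ⊆
      Icc ⌈a ^ (m⁻¹ : ℝ)⌉₊ ⌊b ^ (m⁻¹ : ℝ)⌋₊ := by
    intro n hn
    obtain ⟨-, han, hnb⟩ := mem_filter.mp hn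
    rw [← Real.rpow_inv_natCast_pow ha (by omega : m ≠ 0)] at han
    rw [← Real.rpow_inv_natCast_pow hb0 (by omega : m ≠ 0)] at hnb
    exact mem_Icc.mpr ⟨Nat.ceil_le.mpr (le_of_pow_le_pow_left₀ (by omega) (by positivity) han),
      Nat.le_floor (le_of_pow_le_pow_left₀ (by omega) (by positivity) hnb)⟩
  calc (#{n ∈ s | ((n : ℕ) : ℝ) ^ m ∈ Set.Icc a b} : ℝ)
      ≤ #(Icc ⌈a ^ (m⁻¹ : ℝ)⌉₊ ⌊b ^ (m⁻¹ : ℝ)⌋₊) := by exact_mod_cast card_le_card hsub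
    _ ≤ b ^ (m⁻¹ : ℝ) - a ^ (m⁻¹ : ℝ) + 1 := card_Icc_ceil_floor_le (by positivity) (by gcongr)
    _ ≤ ε * √b / m + 1 := by
        gcongr
        exact rpow_inv_sub_rpow_inv_le ha hb hε hba hm

theorem sum_Ioc_one_inv_le_log {M : ℕ} (hM : 1 ≤ M) :
    ∑ m ∈ Ioc 1 M, ((m : ℝ))⁻¹ ≤ Real.log M := by
  have h := harmonic_le_one_add_log M
  rw [harmonic_eq_sum_Icc, Icc_eq_cons_Ioc hM, sum_cons] at h
  push_cast at h
  linarith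

theorem natLog_two_floor_le {b : ℝ} (hb : 1 ≤ b) :
    (Nat.log 2 ⌊b⌋₊ : ℝ) ≤ Real.log b / Real.log 2 := by
  rw [le_div_iff₀ (Real.log_pos one_lt_two), ← Real.log_pow]
  refine Real.log_le_log (by positivity) ?_
  calc (2 : ℝ) ^ Nat.log 2 ⌊b⌋₊ ≤ ⌊b⌋₊ := by
        exact_mod_cast Nat.pow_log_le_self 2 (Nat.floor_pos.mpr hb).ne'
    _ ≤ b := Nat.floor_le (zero_le_one.trans hb)

section WeightedSum

variable {f : ℝ → ℝ} {a b C ε : ℝ}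

theorem log_mul_indicator_pow_le (hf : ∀ t ∈ Set.Icc a b, 0 ≤ f t) {p m : ℕ} (hp : 1 ≤ p)
    (hm : 1 ≤ m) : Real.log p * (Set.Icc a b).indicator f ((p : ℝ) ^ m) ≤
      Real.log b * ((m : ℝ)⁻¹ * (Set.Icc a b).indicator f ((p : ℝ) ^ m)) := by
  by_cases h : (p : ℝ) ^ m ∈ Set.Icc a b
  · have hlog : m * Real.log p ≤ Real.log b := by
      rw [← Real.log_pow]
      exact Real.log_le_log (by positivity) h.2
    rw [Set.indicator_of_mem h, ← mul_assoc]
    refine mul_le_mul_of_nonneg_right ?_ (hf _ h)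
    rwa [← div_eq_mul_inv, le_div_iff₀' (by positivity)]
  · simp only [Set.indicator_of_notMem h, mul_zero, le_refl]

theorem sum_indicator_pow_le (s : Finset ℕ) (hfC : ∀ t ∈ Set.Icc a b, f t ≤ C) (hC : 0 ≤ C)
    (ha : 0 ≤ a) (hb : 1 ≤ b) (hab : a ≤ b) (hε : 0 ≤ ε) (hba : b ≤ Real.exp ε * a) {m : ℕ}
    (hm : 2 ≤ m) :
    ∑ p ∈ s, (Set.Icc a b).indicator f ((p : ℝ) ^ m) ≤ C * (ε * √b / m + 1) := by
  simp only [Set.indicator_apply]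
  rw [← sum_filter]
  calc ∑ p ∈ s with ((p : ℕ) : ℝ) ^ m ∈ Set.Icc a b, f ((p : ℝ) ^ m)
      ≤ #{p ∈ s | ((p : ℕ) : ℝ) ^ m ∈ Set.Icc a b} • C :=
        sum_le_card_nsmul _ _ _ fun p hp => hfC _ (mem_filter.mp hp).2
    _ ≤ C * (ε * √b / m + 1) := by
        rw [nsmul_eq_mul, mul_comm]
        gcongr
        exact card_filter_pow_mem_Icc_le s ha hb hab hε hba hm

theorem sum_higher_powers_le (s : Finset ℕ) (hfC : ∀ t ∈ Set.Icc a b, f t ≤ C) (hC : 0 ≤ C)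
    (ha : 0 ≤ a) (hb : 1 ≤ b) (hab : a ≤ b) (hε : 0 ≤ ε) (hba : b ≤ Real.exp ε * a) {M : ℕ}
    (hM : 1 ≤ M) :
    ∑ m ∈ Ioc 1 M, (m : ℝ)⁻¹ * ∑ p ∈ s, (Set.Icc a b).indicator f ((p : ℝ) ^ m) ≤
      C * (ε * √b + Real.log M) := by
  have hsq : ∑ m ∈ Ioc 1 M, ((m : ℝ) ^ 2)⁻¹ ≤ 1 := by
    refine (sum_Ioc_inv_sq_le_sub one_ne_zero hM).trans ?_
    rw [Nat.cast_one, inv_one, sub_le_self_iff]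
    positivity
  calc ∑ m ∈ Ioc 1 M, (m : ℝ)⁻¹ * ∑ p ∈ s, (Set.Icc a b).indicator f ((p : ℝ) ^ m)
      ≤ ∑ m ∈ Ioc 1 M, (m : ℝ)⁻¹ * (C * (ε * √b / m + 1)) := by
        gcongr with m hm
        exact sum_indicator_pow_le s hfC hC ha hb hab hε hba (mem_Ioc.mp hm).1
    _ = C * (ε * √b * ∑ m ∈ Ioc 1 M, ((m : ℝ) ^ 2)⁻¹ + ∑ m ∈ Ioc 1 M, (m : ℝ)⁻¹) := by
        rw [mul_sum, ← sum_add_distrib, mul_sum]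
        exact sum_congr rfl fun m _ => by ring
    _ ≤ C * (ε * √b * 1 + Real.log M) := by
        gcongr
        exact sum_Ioc_one_inv_le_log hM
    _ = C * (ε * √b + Real.log M) := by rw [mul_one]

theorem sum_primes_indicator_eq (ha : 0 < a) (hb : 0 ≤ b) :
    ∑ p ∈ Icc 1 ⌊b⌋₊ with p.Prime, (Set.Icc a b).indicator f (p : ℝ) =
      ∑ p ∈ Icc ⌈a⌉₊ ⌊b⌋₊ with p.Prime, f p := by
  simp only [Set.indicator_apply]
  rw [← sum_filter, filter_filter]
  refine sum_congr ?_ fun _ _ => rfl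
  ext p
  simp only [mem_filter, mem_Icc, Set.mem_Icc, Nat.ceil_le, Nat.le_floor_iff hb]
  have hpos : a ≤ p → 1 ≤ p := fun h => Nat.cast_pos.mp (ha.trans_le h)
  tauto

theorem tsum_primePow_indicator_le (hf : ∀ t ∈ Set.Icc a b, 0 ≤ f t)
    (hfC : ∀ t ∈ Set.Icc a b, f t ≤ C) (hC : 0 ≤ C) (ha : 0 < a) (hb : 2 ≤ b) (hab : a ≤ b)
    (hε : 0 ≤ ε) (hba : b ≤ Real.exp ε * a) :
    ∑' q : Nat.Primes × ℕ+, Real.log (q.1 : ℝ) *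
        (Set.Icc a b).indicator f ((q.1 : ℝ) ^ (q.2 : ℕ)) ≤
      Real.log b * (∑ p ∈ Icc ⌈a⌉₊ ⌊b⌋₊ with p.Prime, f p +
        C * (ε * √b + Real.log (Real.log b / Real.log 2))) := by
  have hb1 : 1 ≤ b := one_le_two.trans hb
  have hM : 1 ≤ Nat.log 2 ⌊b⌋₊ :=
    Nat.le_log_of_pow_le one_lt_two (by simpa using Nat.le_floor (n := 2) (by exact_mod_cast hb))
  have hsupp (p m : ℕ) (hp : p.Prime) (hm : 1 ≤ m)
      (h : Real.log p * (Set.Icc a b).indicator f ((p : ℝ) ^ m) ≠ 0) :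
      p ≤ ⌊b⌋₊ ∧ m ≤ Nat.log 2 ⌊b⌋₊ :=
    prime_le_and_exponent_le hp hm (Set.mem_of_indicator_ne_zero (right_ne_zero_of_mul h)).2
  rw [tsum_primes_pnat_eq_sum
    (F := fun p m => Real.log p * (Set.Icc a b).indicator f ((p : ℝ) ^ m)) hsupp]
  calc _ ≤ ∑ m ∈ Icc 1 (Nat.log 2 ⌊b⌋₊), ∑ p ∈ Icc 1 ⌊b⌋₊ with p.Prime,
          Real.log b * ((m : ℝ)⁻¹ * (Set.Icc a b).indicator f ((p : ℝ) ^ m)) := by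
        refine sum_le_sum fun m hm => sum_le_sum fun p hp => ?_
        exact log_mul_indicator_pow_le hf (mem_filter.mp hp).2.one_lt.le (mem_Icc.mp hm).1
    _ = Real.log b * (∑ p ∈ Icc ⌈a⌉₊ ⌊b⌋₊ with p.Prime, f p + ∑ m ∈ Ioc 1 (Nat.log 2 ⌊b⌋₊),
          (m : ℝ)⁻¹ * ∑ p ∈ Icc 1 ⌊b⌋₊ with p.Prime,
            (Set.Icc a b).indicator f ((p : ℝ) ^ m)) := by
        simp_rw [← mul_sum]
        rw [Icc_eq_cons_Ioc hM, sum_cons, ← sum_primes_indicator_eq ha (by linarith)]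
        simp only [Nat.cast_one, inv_one, one_mul, pow_one]
    _ ≤ _ := by
        refine mul_le_mul_of_nonneg_left (add_le_add_right ?_ _) (Real.log_nonneg hb1)
        refine (sum_higher_powers_le _ hfC hC ha.le hb1 hab hε hba hM).trans ?_
        gcongr
        exact natLog_two_floor_le hb1

end WeightedSum

end PrimePowers

section NearbyPrimePowers

open MeasureTheory Set

variable {c ε x : ℝ}

theorem log_sub_log_le_iff {t y : ℝ} (hx : 0 < x) (ht : 0 < t) :
    Real.log t - Real.log x ≤ y ↔ t ≤ Real.exp y * x := by
  rw [← Real.log_div ht.ne' hx.ne', Real.log_le_iff_le_exp (by positivity), div_le_iff₀ hx]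

theorem le_log_sub_log_iff {t y : ℝ} (hx : 0 < x) (ht : 0 < t) :
    y ≤ Real.log t - Real.log x ↔ Real.exp y * x ≤ t := by
  rw [← Real.log_div ht.ne' hx.ne', Real.le_log_iff_exp_le (by positivity), le_div_iff₀ hx]

/-- The mass of `η_{c,ε}` beyond the logarithmic distance from `t` to `x`. Up to a factor
`e^{ε/2}` it bounds the difference at `t` between the sharp cutoff of the primes at `x` and the
smoothed one. -/
def tailWeight (c ε x t : ℝ) : ℝ := etaTail c (|Real.log t - Real.log x| / ε)

theorem tailWeight_nonneg (hc : 0 < c) (ε x t : ℝ) : 0 ≤ tailWeight c ε x t :=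
  etaTail_nonneg hc _

theorem tailWeight_le {α t : ℝ} (hc : 0 < c) (hε : 0 < ε)
    (h : α * ε ≤ |Real.log t - Real.log x|) : tailWeight c ε x t ≤ etaTail c α :=
  antitone_etaTail hc ((le_div_iff₀ hε).mpr h)

theorem antitoneOn_tailWeight (hc : 0 < c) (hε : 0 ≤ ε) (hx : 0 < x) :
    AntitoneOn (tailWeight c ε x) (Ici x) := by
  intro s hs t _ hst
  refine antitone_etaTail hc (div_le_div_of_nonneg_right (abs_le_abs_of_nonneg ?_ ?_) hε)
  · exact sub_nonneg.mpr (Real.log_le_log hx hs)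
  · exact sub_le_sub_right (Real.log_le_log (hx.trans_le hs) hst) _

theorem monotoneOn_tailWeight (hc : 0 < c) (hε : 0 ≤ ε) :
    MonotoneOn (tailWeight c ε x) (Ioc 0 x) := by
  intro s hs t ht hst
  refine antitone_etaTail hc (div_le_div_of_nonneg_right (abs_le_abs_of_nonpos ?_ ?_) hε)
  · exact sub_nonpos.mpr (Real.log_le_log ht.1 ht.2)
  · exact sub_le_sub_right (Real.log_le_log hs.1 hst) _

theorem integral_comp_log_sub_log {g : ℝ → ℝ} (hg : Continuous g) (hx : 0 < x) (u v : ℝ) :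
    ∫ t in Real.exp u * x..Real.exp v * x, g (Real.log t - Real.log x) =
      x * ∫ s in u..v, g s * Real.exp s := by
  have hcont : ContinuousOn (fun t => g (Real.log t - Real.log x))
      ((fun s => Real.exp s * x) '' uIcc u v) := by
    refine hg.comp_continuousOn ((Real.continuousOn_log.mono ?_).sub continuousOn_const)
    rintro - ⟨s, -, rfl⟩
    exact (mul_pos (Real.exp_pos s) hx).ne'
  rw [← intervalIntegral.integral_comp_mul_deriv'
    (fun s _ => (Real.hasDerivAt_exp s).mul_const x) (by fun_prop) hcont,
    ← intervalIntegral.integral_const_mul]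
  refine intervalIntegral.integral_congr fun s _ => ?_
  simp only [Function.comp_apply]
  rw [Real.log_mul (Real.exp_ne_zero s) hx.ne', Real.log_exp, add_sub_cancel_right]
  ring

theorem continuous_etaTail_abs_div (c ε : ℝ) : Continuous fun s => etaTail c (|s| / ε) :=
  (continuous_etaTail c).comp (by fun_prop)

theorem integral_tailWeight_le {u v : ℝ} (hc : 0 < c) (hx : 0 < x) (huv : u ≤ v) (hv : v ≤ ε) :
    ∫ t in Real.exp u * x..Real.exp v * x, tailWeight c ε x t ≤
      Real.exp ε * (x * ∫ s in u..v, etaTail c (|s| / ε)) := by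
  have hcont := continuous_etaTail_abs_div c ε
  calc ∫ t in Real.exp u * x..Real.exp v * x, tailWeight c ε x t
      = x * ∫ s in u..v, etaTail c (|s| / ε) * Real.exp s :=
        integral_comp_log_sub_log hcont hx u v
    _ ≤ x * ∫ s in u..v, etaTail c (|s| / ε) * Real.exp ε := by
        refine mul_le_mul_of_nonneg_left (intervalIntegral.integral_mono_on huv ?_ ?_ ?_) hx.le
        · exact (hcont.mul Real.continuous_exp).intervalIntegrable _ _
        · exact (hcont.mul continuous_const).intervalIntegrable _ _
        · exact fun s hs => mul_le_mul_of_nonneg_left (Real.exp_le_exp.mpr (hs.2.trans hv))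
            (etaTail_nonneg hc _)
    _ = Real.exp ε * (x * ∫ s in u..v, etaTail c (|s| / ε)) := by
        rw [intervalIntegral.integral_mul_const]
        ring

theorem integral_etaTail_abs_div {α : ℝ} (hc : 0 < c) (hε : 0 < ε) (hα₀ : 0 ≤ α) (hα : α ≤ 1) :
    ∫ s in α * ε..ε, etaTail c (|s| / ε) = ε * |nuFun c 1 α| := by
  calc ∫ s in α * ε..ε, etaTail c (|s| / ε) = ∫ s in α * ε..ε, etaTail c (s / ε) := by
        refine intervalIntegral.integral_congr fun s hs => ?_
        rw [uIcc_of_le (mul_le_of_le_one_left hε.le hα)] at hs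
        simp only [abs_of_nonneg ((mul_nonneg hα₀ hε.le).trans hs.1)]
    _ = ε * |nuFun c 1 α| := by
        rw [intervalIntegral.integral_comp_div _ hε.ne', mul_div_cancel_right₀ _ hε.ne',
          div_self hε.ne', smul_eq_mul, abs_nuFun_one hc hα₀ hα]

theorem integral_etaTail_abs_div_neg {α : ℝ} (hc : 0 < c) (hε : 0 < ε) (hα₀ : 0 ≤ α)
    (hα : α ≤ 1) : ∫ s in -ε..-(α * ε), etaTail c (|s| / ε) = ε * |nuFun c 1 α| := by
  rw [← integral_etaTail_abs_div hc hε hα₀ hα, ← intervalIntegral.integral_comp_neg]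
  simp_rw [abs_neg]

theorem boundB_eq (x c ε : ℝ) {α : ℝ} (hα : 0 ≤ α) :
    boundB x c ε α = ε * x * Real.exp (-ε) * |nuFun c 1 α| / (2 * etaTail c α) := by
  rw [boundB, rightLim_muFun_one c hα]

theorem etaTail_pos_of_one_lt_boundB {α : ℝ} (hc : 0 < c) (hα : 0 ≤ α)
    (hB : 1 < boundB x c ε α) : 0 < etaTail c α := by
  refine (etaTail_nonneg hc α).lt_of_ne fun h => ?_
  rw [boundB_eq x c ε hα, ← h, mul_zero, div_zero] at hB
  exact zero_lt_one.not_gt hB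

theorem boundB_le {α : ℝ} (hc : 0 < c) (hε : 0 ≤ ε) (hx : 0 ≤ x) (hα : 0 ≤ α) :
    boundB x c ε α ≤ Real.exp ε * (ε * x * |nuFun c 1 α|) / (2 * etaTail c α) := by
  rw [boundB_eq x c ε hα, mul_right_comm, mul_comm _ (Real.exp _)]
  have htail := etaTail_nonneg hc α
  gcongr
  linarith

theorem exp_mul_abs_nuFun_le {α : ℝ} (hc : 0 < c) (hα₀ : 0 ≤ α) (hα : α ≤ 1) (hx : 0 ≤ x)
    (hε₀ : 0 ≤ ε) (hε : ε ≤ 1 / 2) :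
    Real.exp ε * (ε * x * |nuFun c 1 α|) ≤ x * etaTail c α := by
  have hexp : Real.exp ε * ε ≤ 1 := by
    have h := Real.exp_bound_div_one_sub_of_interval hε₀ (by linarith)
    rw [le_div_iff₀ (by linarith)] at h
    nlinarith [Real.exp_pos ε]
  calc Real.exp ε * (ε * x * |nuFun c 1 α|) = Real.exp ε * ε * (x * |nuFun c 1 α|) := by ring
    _ ≤ 1 * (x * |nuFun c 1 α|) := by gcongr
    _ ≤ x * etaTail c α := by
        rw [one_mul]
        exact mul_le_mul_of_nonneg_left (abs_nuFun_one_le hc hα₀ hα) hx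

theorem sum_primes_tailWeight_le {α a b : ℝ} (hc : 0 < c) (hα₀ : 0 ≤ α) (hα : α ≤ 1)
    (hx : 100 < x) (hε₀ : 0 < ε) (hε : ε ≤ 1 / 2) (hB : 1 < boundB x c ε α)
    (ha : x / 2 ≤ a) (hab : a ≤ b)
    (hmono : AntitoneOn (tailWeight c ε x) (Icc a b) ∨ MonotoneOn (tailWeight c ε x) (Icc a b))
    (hfar : ∀ t ∈ Icc a b, α * ε ≤ |Real.log t - Real.log x|)
    (hint : ∫ t in a..b, tailWeight c ε x t ≤ Real.exp ε * (ε * x * |nuFun c 1 α|)) :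
    ∑ p ∈ Finset.Icc ⌈a⌉₊ ⌊b⌋₊ with p.Prime, tailWeight c ε x p ≤
      Real.exp ε * (2 * ε * x * |nuFun c 1 α| / Real.log (boundB x c ε α)) := by
  have hx0 : 0 < x := by linarith
  have hM : 0 < etaTail c α := etaTail_pos_of_one_lt_boundB hc hα₀ hB
  have hratio := boundB_le hc hε₀.le hx0.le hα₀
  have hMW : 2 * etaTail c α < Real.exp ε * (ε * x * |nuFun c 1 α|) :=
    (one_lt_div (by positivity)).mp (hB.trans_le hratio)
  have hlevel : √(Real.exp ε * (ε * x * |nuFun c 1 α|) / etaTail c α) < a := by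
    calc √(Real.exp ε * (ε * x * |nuFun c 1 α|) / etaTail c α) ≤ √x :=
          Real.sqrt_le_sqrt
            ((div_le_iff₀ hM).mpr (exp_mul_abs_nuFun_le hc hα₀ hα hx0.le hε₀.le hε))
      _ < x / 2 := (Real.sqrt_lt' (by linarith)).mpr (by nlinarith)
      _ ≤ a := ha
  calc ∑ p ∈ Finset.Icc ⌈a⌉₊ ⌊b⌋₊ with p.Prime, tailWeight c ε x p
      ≤ 2 * (Real.exp ε * (ε * x * |nuFun c 1 α|)) /
          Real.log (Real.exp ε * (ε * x * |nuFun c 1 α|) / (2 * etaTail c α)) :=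
        sum_primes_le_two_mul_div_log hmono (fun t _ => tailWeight_nonneg hc ε x t)
          (fun t ht => tailWeight_le hc hε₀ (hfar t ht)) hab hint hM hMW (by linarith) hlevel
    _ ≤ 2 * (Real.exp ε * (ε * x * |nuFun c 1 α|)) / Real.log (boundB x c ε α) := by
        have hlogB : 0 < Real.log (boundB x c ε α) := Real.log_pos hB
        gcongr
    _ = Real.exp ε * (2 * ε * x * |nuFun c 1 α| / Real.log (boundB x c ε α)) := by ring

theorem log_div_log_two_le {b : ℝ} (hx : 1 ≤ x) (hε : ε ≤ Real.log 2 ^ 2) (hb : 0 < b)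
    (hbx : b ≤ Real.exp ε * x) : Real.log b / Real.log 2 ≤ Real.log (2 * x ^ 2) := by
  have hlog : Real.log b ≤ ε + Real.log x := by
    linarith [(log_sub_log_le_iff (by linarith) hb).mpr hbx]
  rw [div_le_iff₀ (Real.log_pos one_lt_two), Real.log_mul two_ne_zero (by positivity), Real.log_pow]
  push_cast
  nlinarith [Real.log_nonneg hx, Real.log_two_gt_d9]

theorem one_le_log_two_mul_sq (hx : 100 < x) : 1 ≤ Real.log (2 * x ^ 2) := by
  rw [Real.le_log_iff_exp_le (by positivity)]
  nlinarith [Real.exp_one_lt_d9]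

/-- The right-hand side is `A(x,c,ε,α)` once the first term of the bracket is put for `T`. -/
theorem exp_half_mul_log_mul_le {b S T : ℝ} (hx : 100 < x) (hε₀ : 0 < ε) (hε : ε < 1 / 100)
    (hb : 2 ≤ b) (hbx : b ≤ Real.exp ε * x) (hT : 0 ≤ T) (hS : S ≤ Real.exp ε * T) :
    Real.exp (ε / 2) * (Real.log b *
        (S + 1 / 2 * (ε * √b + Real.log (Real.log b / Real.log 2)))) ≤
      Real.exp (2 * ε) * Real.log (Real.exp ε * x) *
        (T + 2.01 * ε * √x + 1 / 2 * Real.log (Real.log (2 * x ^ 2))) := by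
  set LL := Real.log (Real.log (2 * x ^ 2))
  have hLL : 0 ≤ LL := Real.log_nonneg (one_le_log_two_mul_sq hx)
  have hlogb : 0 < Real.log b := Real.log_pos (by linarith)
  have hlog2 : 0 < Real.log 2 := Real.log_pos one_lt_two
  have hhalf : Real.exp (ε / 2) ≤ Real.exp ε := Real.exp_le_exp.mpr (by linarith)
  have hsqrt : √b ≤ Real.exp ε * √x := by
    calc √b ≤ √(Real.exp ε * x) := Real.sqrt_le_sqrt hbx
      _ = Real.exp (ε / 2) * √x := by rw [Real.sqrt_mul (Real.exp_pos _).le, Real.exp_half]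
      _ ≤ Real.exp ε * √x := by gcongr
  have hloglog : Real.log (Real.log b / Real.log 2) ≤ Real.exp ε * LL := by
    refine (Real.log_le_log (by positivity) (log_div_log_two_le (by linarith) ?_ (by linarith)
      hbx)).trans (le_mul_of_one_le_left hLL (Real.one_le_exp hε₀.le))
    nlinarith [Real.log_two_gt_d9]
  have hbracket : S + 1 / 2 * (ε * √b + Real.log (Real.log b / Real.log 2)) ≤
      Real.exp ε * (T + 2.01 * ε * √x + 1 / 2 * LL) := by
    have hpos : 0 ≤ Real.exp ε * (ε * √x) := by positivity
    linarith [mul_le_mul_of_nonneg_left hsqrt hε₀.le]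
  calc Real.exp (ε / 2) * (Real.log b *
        (S + 1 / 2 * (ε * √b + Real.log (Real.log b / Real.log 2))))
      ≤ Real.exp (ε / 2) * (Real.log b *
          (Real.exp ε * (T + 2.01 * ε * √x + 1 / 2 * LL))) := by gcongr
    _ ≤ Real.exp ε * (Real.log (Real.exp ε * x) *
          (Real.exp ε * (T + 2.01 * ε * √x + 1 / 2 * LL))) := by gcongr
    _ = Real.exp (2 * ε) * Real.log (Real.exp ε * x) *
          (T + 2.01 * ε * √x + 1 / 2 * LL) := by
        rw [two_mul, Real.exp_add]
        ring

theorem exp_half_mul_tsum_tailWeight_le {α a b : ℝ} (hc : 0 < c) (hα₀ : 0 ≤ α) (hα : α ≤ 1)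
    (hx : 100 < x) (hε₀ : 0 < ε) (hε : ε < 1 / 100) (hB : 1 < boundB x c ε α)
    (ha : Real.exp (-ε) * x ≤ a) (hab : a ≤ b) (hb : b ≤ Real.exp ε * x)
    (hba : b ≤ Real.exp ε * a)
    (hmono : AntitoneOn (tailWeight c ε x) (Icc a b) ∨ MonotoneOn (tailWeight c ε x) (Icc a b))
    (hfar : ∀ t ∈ Icc a b, α * ε ≤ |Real.log t - Real.log x|)
    (hint : ∫ t in a..b, tailWeight c ε x t ≤ Real.exp ε * (ε * x * |nuFun c 1 α|)) :
    Real.exp (ε / 2) * ∑' q : Nat.Primes × ℕ+, Real.log (q.1 : ℝ) *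
        (Icc a b).indicator (tailWeight c ε x) ((q.1 : ℝ) ^ (q.2 : ℕ)) ≤
      boundA x c ε α := by
  have hxa : x / 2 ≤ a := by nlinarith [Real.add_one_le_exp (-ε)]
  have hhalf (t : ℝ) (_ : t ∈ Icc a b) : tailWeight c ε x t ≤ 1 / 2 :=
    (tailWeight_le hc hε₀ (by rw [zero_mul]; exact abs_nonneg _)).trans_eq (etaTail_zero hc)
  have hlogB : 0 < Real.log (boundB x c ε α) := Real.log_pos hB
  refine (mul_le_mul_of_nonneg_left (tsum_primePow_indicator_le
    (fun t _ => tailWeight_nonneg hc ε x t) hhalf (by norm_num) (by linarith) (by linarith) hab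
    hε₀.le hba) (Real.exp_pos _).le).trans ?_
  exact exp_half_mul_log_mul_le hx hε₀ hε (by linarith) hb (by positivity)
    (sum_primes_tailWeight_le hc hα₀ hα hx hε₀ (by linarith) hB hxa hab hmono hfar hint)

theorem exp_half_mul_tsum_tailWeight_above_le {α : ℝ} (hc : 0 < c) (hα₀ : 0 ≤ α) (hα : α ≤ 1)
    (hx : 100 < x) (hε₀ : 0 < ε) (hε : ε < 1 / 100) (hB : 1 < boundB x c ε α) :
    Real.exp (ε / 2) * ∑' q : Nat.Primes × ℕ+, Real.log (q.1 : ℝ) *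
        (Icc (Real.exp (α * ε) * x) (Real.exp ε * x)).indicator (tailWeight c ε x)
          ((q.1 : ℝ) ^ (q.2 : ℕ)) ≤
      boundA x c ε α := by
  have hx0 : 0 < x := by linarith
  have hαε₀ : 0 ≤ α * ε := by positivity
  have hαε : α * ε ≤ ε := mul_le_of_le_one_left hε₀.le hα
  have hxa : x ≤ Real.exp (α * ε) * x := le_mul_of_one_le_left hx0.le (Real.one_le_exp hαε₀)
  refine exp_half_mul_tsum_tailWeight_le hc hα₀ hα hx hε₀ hε hB (by gcongr; linarith) (by gcongr)
    le_rfl (by gcongr) (.inl ?_) (fun t ht => ?_) ?_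
  · exact (antitoneOn_tailWeight hc hε₀.le hx0).mono fun t ht => hxa.trans ht.1
  · exact ((le_log_sub_log_iff hx0 (hx0.trans_le (hxa.trans ht.1))).mpr ht.1).trans (le_abs_self _)
  · refine (integral_tailWeight_le hc hx0 hαε le_rfl).trans_eq ?_
    rw [integral_etaTail_abs_div hc hε₀ hα₀ hα]
    ring

theorem exp_half_mul_tsum_tailWeight_below_le {α : ℝ} (hc : 0 < c) (hα₀ : 0 ≤ α) (hα : α ≤ 1)
    (hx : 100 < x) (hε₀ : 0 < ε) (hε : ε < 1 / 100) (hB : 1 < boundB x c ε α) :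
    Real.exp (ε / 2) * ∑' q : Nat.Primes × ℕ+, Real.log (q.1 : ℝ) *
        (Icc (Real.exp (-ε) * x) (Real.exp (-(α * ε)) * x)).indicator (tailWeight c ε x)
          ((q.1 : ℝ) ^ (q.2 : ℕ)) ≤
      boundA x c ε α := by
  have hx0 : 0 < x := by linarith
  have hαε₀ : 0 ≤ α * ε := by positivity
  have hαε : α * ε ≤ ε := mul_le_of_le_one_left hε₀.le hα
  have ha0 : 0 < Real.exp (-ε) * x := by positivity
  have hbx : Real.exp (-(α * ε)) * x ≤ x :=
    mul_le_of_le_one_left hx0.le (Real.exp_le_one_iff.mpr (by linarith))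
  refine exp_half_mul_tsum_tailWeight_le hc hα₀ hα hx hε₀ hε hB le_rfl (by gcongr)
    (by gcongr; linarith) ?_ (.inr ?_) (fun t ht => ?_) ?_
  · rwa [← mul_assoc, ← Real.exp_add, add_neg_cancel, Real.exp_zero, one_mul]
  · exact (monotoneOn_tailWeight hc hε₀.le).mono fun t ht =>
      ⟨ha0.trans_le ht.1, ht.2.trans hbx⟩
  · have h := (log_sub_log_le_iff hx0 (ha0.trans_le ht.1)).mpr ht.2
    exact (le_neg_of_le_neg h).trans (neg_le_abs _)
  · refine (integral_tailWeight_le hc hx0 (neg_le_neg hαε) (by linarith)).trans_eq ?_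
    rw [integral_etaTail_abs_div_neg hc hε₀ hα₀ hα]
    ring

theorem chiStar_le_etaKernel_add {α n : ℝ} (hc : 0 < c) (hα : 0 ≤ α) (hε : 0 < ε) (hx : 0 < x)
    (hn : 0 < n) :
    chiStar (Icc 0 (Real.exp (-(α * ε)) * x)) n ≤
      etaKernel c ε (Real.log n - Real.log x) + Real.exp (ε / 2) *
        (Icc (Real.exp (-ε) * x) (Real.exp (-(α * ε)) * x)).indicator (tailWeight c ε x) n := by
  set u := Real.log n - Real.log x
  have hw := indicator_nonneg (s := Icc (Real.exp (-ε) * x) (Real.exp (-(α * ε)) * x))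
    (fun t _ => tailWeight_nonneg hc ε x t) n
  have hK₀ := etaKernel_nonneg hc hε u
  have hK := one_sub_etaKernel_le hc hε u
  have hexp := Real.exp_pos (ε / 2)
  by_cases hnb : n ≤ Real.exp (-(α * ε)) * x
  · refine (chiStar_le_one _ _).trans ?_
    by_cases han : Real.exp (-ε) * x ≤ n
    · have hu : u ≤ 0 := ((log_sub_log_le_iff hx hn).mpr hnb).trans (by nlinarith)
      rw [indicator_of_mem (mem_Icc.mpr ⟨han, hnb⟩), tailWeight, abs_of_nonpos hu]
      linarith
    · have hu : u ≤ -ε := (log_sub_log_le_iff hx hn).mpr (not_le.mp han).le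
      rw [etaTail_eq_zero c ((one_le_div hε).mpr (by linarith))] at hK
      nlinarith
  · rw [chiStar_Icc_of_notMem (by positivity) fun h => hnb h.2]
    positivity

theorem etaKernel_le_chiStar_add {α n : ℝ} (hc : 0 < c) (hα : 0 ≤ α) (hε : 0 < ε) (hx : 0 < x)
    (hn : 0 < n) :
    etaKernel c ε (Real.log n - Real.log x) ≤
      chiStar (Icc 0 (Real.exp (α * ε) * x)) n + Real.exp (ε / 2) *
        (Icc (Real.exp (α * ε) * x) (Real.exp ε * x)).indicator (tailWeight c ε x) n := by
  set u := Real.log n - Real.log x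
  have hw := indicator_nonneg (s := Icc (Real.exp (α * ε) * x) (Real.exp ε * x))
    (fun t _ => tailWeight_nonneg hc ε x t) n
  have hχ := chiStar_nonneg (Icc 0 (Real.exp (α * ε) * x)) n
  have hexp : 1 ≤ Real.exp (ε / 2) := Real.one_le_exp (by linarith)
  rcases lt_or_ge n (Real.exp (α * ε) * x) with hna | han
  · rw [chiStar_Icc_of_mem_Ioo ⟨hn, hna⟩]
    nlinarith [etaKernel_le_one hc hε u]
  rcases le_or_gt n (Real.exp ε * x) with hnb | hbn
  · have hu : 0 ≤ u := (by positivity : 0 ≤ α * ε).trans ((le_log_sub_log_iff hx hn).mpr han)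
    have hK : etaKernel c ε u ≤ tailWeight c ε x n := by
      rw [tailWeight, abs_of_nonneg hu]
      exact etaKernel_le hc hε hu
    rw [indicator_of_mem (mem_Icc.mpr ⟨han, hnb⟩)] at hw ⊢
    nlinarith
  · rw [etaKernel_eq_zero hc hε ((le_log_sub_log_iff hx hn).mpr hbn.le)]
    positivity

theorem primePow_pos (q : Nat.Primes × ℕ+) : (0 : ℝ) < (q.1 : ℝ) ^ (q.2 : ℕ) :=
  pow_pos (Nat.cast_pos.mpr q.1.2.pos) _

theorem summable_chiStar_mul_log {y : ℝ} (hy : 0 ≤ y) : Summable fun q : Nat.Primes × ℕ+ =>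
    chiStar (Icc 0 y) ((q.1 : ℝ) ^ (q.2 : ℕ)) * Real.log (q.1 : ℝ) :=
  summable_of_primePow_le y fun q hq => by
    rw [chiStar_Icc_of_notMem hy fun h => h.2.not_gt hq, zero_mul]

theorem summable_log_mul_etaKernel (hc : 0 < c) (hε : 0 < ε) (hx : 0 < x) :
    Summable fun q : Nat.Primes × ℕ+ => Real.log (q.1 : ℝ) *
      etaKernel c ε (Real.log ((q.1 : ℝ) ^ (q.2 : ℕ)) - Real.log x) :=
  summable_of_primePow_le (Real.exp ε * x) fun q hq => by
    rw [etaKernel_eq_zero hc hε ((le_log_sub_log_iff hx (primePow_pos q)).mpr hq.le), mul_zero]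

theorem summable_log_mul_indicator (f : ℝ → ℝ) (a b : ℝ) :
    Summable fun q : Nat.Primes × ℕ+ =>
      Real.log (q.1 : ℝ) * (Icc a b).indicator f ((q.1 : ℝ) ^ (q.2 : ℕ)) :=
  summable_of_primePow_le b fun q hq => by
    rw [indicator_of_notMem fun h => h.2.not_gt hq, mul_zero]

theorem psiStar_le_psiMod_add {α : ℝ} (hc : 0 < c) (hα : 0 ≤ α) (hε₀ : 0 < ε)
    (hε : ε ≤ Real.log 2) (hx : 0 < x) :
    psiStar (Real.exp (-(α * ε)) * x) ≤ psiMod c ε x + Real.exp (ε / 2) *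
      ∑' q : Nat.Primes × ℕ+, Real.log (q.1 : ℝ) *
        (Icc (Real.exp (-ε) * x) (Real.exp (-(α * ε)) * x)).indicator (tailWeight c ε x)
          ((q.1 : ℝ) ^ (q.2 : ℕ)) := by
  have hK := summable_log_mul_etaKernel hc hε₀ hx
  have hw := (summable_log_mul_indicator (tailWeight c ε x) (Real.exp (-ε) * x)
    (Real.exp (-(α * ε)) * x)).mul_left (Real.exp (ε / 2))
  rw [psiStar, psiMod_eq_tsum_etaKernel x c hε₀ hε, ← tsum_mul_left, ← hK.tsum_add hw]
  refine (summable_chiStar_mul_log (by positivity)).tsum_le_tsum (fun q => ?_) (hK.add hw)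
  rw [mul_left_comm, ← mul_add, mul_comm]
  exact mul_le_mul_of_nonneg_left (chiStar_le_etaKernel_add hc hα hε₀ hx (primePow_pos q))
    (Real.log_natCast_nonneg _)

theorem psiMod_le_psiStar_add {α : ℝ} (hc : 0 < c) (hα : 0 ≤ α) (hε₀ : 0 < ε)
    (hε : ε ≤ Real.log 2) (hx : 0 < x) :
    psiMod c ε x ≤ psiStar (Real.exp (α * ε) * x) + Real.exp (ε / 2) *
      ∑' q : Nat.Primes × ℕ+, Real.log (q.1 : ℝ) *
        (Icc (Real.exp (α * ε) * x) (Real.exp ε * x)).indicator (tailWeight c ε x)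
          ((q.1 : ℝ) ^ (q.2 : ℕ)) := by
  have hχ := summable_chiStar_mul_log (y := Real.exp (α * ε) * x) (by positivity)
  have hw := (summable_log_mul_indicator (tailWeight c ε x) (Real.exp (α * ε) * x)
    (Real.exp ε * x)).mul_left (Real.exp (ε / 2))
  rw [psiStar, psiMod_eq_tsum_etaKernel x c hε₀ hε, ← tsum_mul_left, ← hχ.tsum_add hw]
  refine (summable_log_mul_etaKernel hc hε₀ hx).tsum_le_tsum (fun q => ?_) (hχ.add hw)
  rw [mul_left_comm, mul_comm (chiStar _ _), ← mul_add]
  exact mul_le_mul_of_nonneg_left (etaKernel_le_chiStar_add hc hα hε₀ hx (primePow_pos q))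
    (Real.log_natCast_nonneg _)

end NearbyPrimePowers

end

theorem mainTheorem5 (x c ε α : ℝ) (hc : 0 < c) (hα₀ : 0 ≤ α) (hα₁ : α < 1)
    (hx : 100 < x) (hε₀ : 0 < ε) (hε : ε < 1 / 100) (hB : 1 < boundB x c ε α) :
    psiStar (Real.exp (-(α * ε)) * x) ≤ psiMod c ε x + boundA x c ε α ∧
      psiMod c ε x - boundA x c ε α ≤ psiStar (Real.exp (α * ε) * x) := by
  have hx0 : 0 < x := by linarith
  have hεlog : ε ≤ Real.log 2 := by linarith [Real.log_two_gt_d9]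
  constructor
  · refine (psiStar_le_psiMod_add hc hα₀ hε₀ hεlog hx0).trans (add_le_add_right ?_ _)
    exact exp_half_mul_tsum_tailWeight_below_le hc hα₀ hα₁.le hx hε₀ hε hB
  · refine sub_le_iff_le_add.mpr ((psiMod_le_psiStar_add hc hα₀ hε₀ hεlog hx0).trans
      (add_le_add_right ?_ _))
    exact exp_half_mul_tsum_tailWeight_above_le hc hα₀ hα₁.le hx hε₀ hε hB
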